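/- **Setting.** Let $n,k,m$ be positive integers with $k\ge 2$, $q\in(0,1/2)$, and let $P_1,\dots,P_k\in\{0,1\}^n$. Write $D(u,v)=\sum_{s=1}^n|u(s)-v(s)|$ for $u,v\in\mathbb R^n$, and $c=\min_{i\ne j}D(P_i,P_j)/n$. Let $w_1,\dots,w_k$ be weights with $\sum_i w_i=1$ and $w_i\ge w_{\min}>0$ for all $i$. Draw $m$ independent examples: the $j$-th has label $i$ with probability $w_i$, and, given the label $i$, $x_j\in\{0,1\}^n$ is obtained from $P_i$ by switching each component independently with probability $q$. Let $S_i$ be the collection of examples with label $i$ and $\mathrm{mean}(S_i)$ its average. Put $$B=\tfrac12(1-2q)\ln\frac{1}{(1-q)(4q+\sqrt q)},$$ $$E=\min\Big(\tfrac14,\ \frac{c(1-2q)^2/2}{c(1-2q)^2+2(1-q)(q+\sqrt q)},\ \frac{3c(1-2q)/4-2q-4\sqrt{6ql/n}}{c(1-2q)+q+\sqrt q}\Big),$$ and assume $B>0$. **Two-round EM.** For templates $T_1,\dots,T_r\in\mathbb R^n$ and $q'\in[0,1/2]$, one EM step with equal weights computes $f_i(x_j)=q'^{D(x_j,T_i)}(1-q')^{n-D(x_j,T_i)}$,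 $p_i(x_j)=f_i(x_j)/\sum_{i'}f_{i'}(x_j)$ (if this is $0/0$, which happens only for $q'=0$, it is replaced by its limit as $q'\downarrow0$), then the new weights $w_i'=\frac1m\sum_jp_i(x_j)$ and the new templates $T_i'=\frac1{mw_i'}\sum_jp_i(x_j)x_j$. 1. Let $T^{(0)}_1,\dots,T^{(0)}_l$ be $l$ distinct training examples (that is, with distinct indices) chosen uniformly at random, independently of the data, and let $q_0\in[0,1/2]$ satisfy $q_0(1-q_0)=\frac1{2n}\min_{i\ne j}D(T^{(0)}_i,T^{(0)}_j)$. 2. Apply one EM step with noise level $q_0$ to get weights $w^{(1)}_i$ and templates $T^{(1)}_i$, $i\le l$. 3. Remove all $T^{(1)}_i$ with $w_i^{(1)}<\frac1{4l}$. From the remaining ones select $k$: start with an arbitrary one, then repeatedly add a template, not yet selected, whose minimum distance to the selected ones is largest (ties broken arbitrarily). 4. Apply one EM step with noise level $q_0$ to the $k$ selected templates to get weights $w^{(2)}_i$ and templates $T^{(2)}_i$. **Theorem.** Let $\epsilon,\delta\in(0,1)$ and suppose that 1. $l=\Big\lceil\dfrac{4}{w_{\min}}\ln\dfrac{2}{\delta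 w_{\min}}\Big\rceil$; 2. $m\ge\max\Big(8l,\ 16\ln n,\ \dfrac8{w_{\min}}\ln\dfrac{12k}\delta\Big)$; 3. $c>\max\Big(\dfrac4{nB}\ln\dfrac{5n}{\epsilon w_{\min}},\ \dfrac{\max(3(1-2q),2)}{3(1-2q)}\Big(4q+8\sqrt{\dfrac{6ql}n}\Big),\ \dfrac{\ln\frac{16l}{\min(6nq,1)}}{nB(1-2q)}\Big)$; 4. $n>\max\Big(\dfrac{3}{\min(c,0.5)E^2}\ln\dfrac{12(m+1)^2}\delta,\ \dfrac{6k}\delta\Big)$. Then with probability at least $1-\delta$ the algorithm can be carried out ($q_0$ exists and at least $k$ templates survive the weight threshold), and, whatever first template and tie-breaking are used in the selection, exactly one of the selected templates was initialized from an example of each $S_i$; indexing the selected templates accordingly, $w_i^{(2)}>0$ and, for every $i=1,\dots,k$, $$D(T_i^{(2)},P_i)\le D(\mathrm{mean}(S_i),P_i)+\epsilon q.$$ -/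

import Mathlib

open MeasureTheory ProbabilityTheory Filter Topology

noncomputable section

namespace BernoulliEM

/-- The `ℓ¹` distance `D(u, v) = ∑ₛ |u(s) - v(s)|`. -/
def D {n : ℕ} (u v : Fin n → ℝ) : ℝ := ∑ s, |u s - v s|

/-- A binary vector seen as a real vector with entries `0` and `1`. -/
def vec {n : ℕ} (y : Fin n → Bool) : Fin n → ℝ := fun s => if y s then 1 else 0

/-- The mixture with templates `P` is `c`-separated:
`c` is the minimum over `i ≠ j` of `c_{ij} = D(P_i, P_j) / n`. -/
def IsSeparated {k n : ℕ} (P : Fin k → Fin n → Bool) (c : ℝ) : Prop :=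
  IsLeast {a : ℝ | ∃ i j, i ≠ j ∧ a = D (vec (P i)) (vec (P j)) / n} c

/-- The probability that the template `P`, at noise level `q`, generates the example `y`:
every component is switched independently with probability `q`. -/
def noiseProb {n : ℕ} (q : ℝ) (P y : Fin n → Bool) : ℝ :=
  ∏ s, if y s = P s then 1 - q else q

/-- The random data: `m` independent pairs (label `z j`, example `x j`), where `z j = i` with
probability `w i`, and given `z j = i` the example `x j` is a noisy version of `P i`; and,
independently of them, a uniformly random choice `init` of `l` distinct training examples. -/
structure IsMixtureSample {Ω : Type*} [MeasurableSpace Ω] (μ : Measure Ω) {k n m l : ℕ}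
    (w : Fin k → ℝ) (q : ℝ) (P : Fin k → Fin n → Bool)
    (z : Fin m → Ω → Fin k) (x : Fin m → Ω → Fin n → Bool) (init : Ω → Fin l → Fin m) :
    Prop where
  measurable_label : ∀ j, Measurable (z j)
  measurable_example : ∀ j, Measurable (x j)
  measurable_init : Measurable init
  indep : iIndepFun (fun j ω => (z j ω, x j ω)) μ
  law : ∀ j i y, μ.real {ω | z j ω = i ∧ x j ω = y} = w i * noiseProb q (P i) y
  indep_init : IndepFun init (fun ω j => (z j ω, x j ω)) μ
  law_init : ∀ e : Fin l → Fin m, Function.Injective e →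
    μ.real {ω | init ω = e} = 1 / (m.descFactorial l : ℝ)

section Step

variable {ι : Type*} [Fintype ι] {n m : ℕ}

/-- `f(x) = q ^ D(x, T) * (1 - q) ^ (n - D(x, T))`. -/
def lik (q : ℝ) (T x : Fin n → ℝ) : ℝ := q ^ D x T * (1 - q) ^ ((n : ℝ) - D x T)

open Classical in
/-- The indices of the templates nearest to `x`. -/
def nearest (T : ι → Fin n → ℝ) (x : Fin n → ℝ) : Finset ι :=
  Finset.univ.filter fun i => ∀ j, D x (T i) ≤ D x (T j)

open Classical in
/-- E-step: `p_i(x) = w_i f_i(x) / ∑_{i'} w_{i'} f_{i'}(x)`. If this quotient is `0 / 0` (which,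
for positive weights, happens only for `q = 0` and `x` different from all templates), it is
replaced by its limit as `q ↓ 0`; see `tendsto_posterior`. -/
def posterior (w : ι → ℝ) (q : ℝ) (T : ι → Fin n → ℝ) (x : Fin n → ℝ) (i : ι) : ℝ :=
  if ∑ i', w i' * lik q (T i') x = 0 then
    (if i ∈ nearest T x then w i else 0) / ∑ i' ∈ nearest T x, w i'
  else w i * lik q (T i) x / ∑ i', w i' * lik q (T i') x

/-- M-step, weights: `(∑_j p_i(x_j)) / m`. -/
def emWeight (w : ι → ℝ) (q : ℝ) (T : ι → Fin n → ℝ) (x : Fin m → Fin n → ℝ) (i : ι) : ℝ :=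
  (∑ j, posterior w q T (x j) i) / m

/-- M-step, templates: `(∑_j p_i(x_j) x_j) / (m w_i)`, with the updated weight `w_i`. -/
def emTemplate (w : ι → ℝ) (q : ℝ) (T : ι → Fin n → ℝ) (x : Fin m → Fin n → ℝ) (i : ι) :
    Fin n → ℝ :=
  (1 / (m * emWeight w q T x i)) • ∑ j, posterior w q T (x j) i • x j

/-- The value of `posterior` at noise level `0` is the limit of its values as `q ↓ 0`. -/
theorem tendsto_posterior (w : ι → ℝ) (hw : ∀ i, 0 < w i) (T : ι → Fin n → ℝ)
    (x : Fin n → ℝ) (i : ι) :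
    Tendsto (fun q => posterior w q T x i) (𝓝[>] 0) (𝓝 (posterior w 0 T x i)) := by
  classical
  set d : ι → ℝ := fun j => D x (T j) with hd
  obtain ⟨i₀, -, hi₀⟩ := Finset.exists_min_image Finset.univ d ⟨i, Finset.mem_univ i⟩
  have hi₀' : ∀ j, d i₀ ≤ d j := fun j => hi₀ j (Finset.mem_univ j)
  have hnear : ∀ j, j ∈ nearest T x ↔ d j = d i₀ := by
    intro j
    simp only [nearest, Finset.mem_filter, Finset.mem_univ, true_and]
    exact ⟨fun h => le_antisymm (h i₀) (hi₀' j), fun h j' => (h.le.trans (hi₀' j'))⟩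
  have hd0 : ∀ j, 0 ≤ d j := fun j => Finset.sum_nonneg fun s _ => abs_nonneg _
  have hsum : (∑ j, if j ∈ nearest T x then w j else 0) = ∑ j ∈ nearest T x, w j := by
    rw [← Finset.sum_filter]; congr 1; ext j; simp
  have hpos : 0 < ∑ j ∈ nearest T x, w j :=
    Finset.sum_pos (fun j _ => hw j) ⟨i₀, (hnear i₀).2 rfl⟩
  have h0 : posterior w 0 T x i =
      (if i ∈ nearest T x then w i else 0) / ∑ j ∈ nearest T x, w j := by
    unfold posterior
    split_ifs with h1 h2 h2 <;> try rfl
    all_goals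
      have hl : ∀ j, lik 0 (T j) x = if d j = 0 then 1 else 0 := by
        intro j
        have : D x (T j) = d j := rfl
        by_cases hj : d j = 0 <;> simp [lik, this, hj]
      have hmin : d i₀ = 0 := by
        by_contra hne
        apply h1
        refine Finset.sum_eq_zero fun j _ => ?_
        have : d j ≠ 0 := fun h => hne (le_antisymm (h ▸ hi₀' j) (hd0 i₀))
        simp [hl, this]
      have hl' : ∀ j, w j * lik 0 (T j) x = if j ∈ nearest T x then w j else 0 := by
        intro j
        rw [hl]; simp only [hnear, hmin]; split_ifs <;> simp
      simp only [hl', hsum, h2, if_true, if_false]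
  set g : ℝ → ι → ℝ := fun q j => (q / (1 - q)) ^ (d j - d i₀) with hg
  have hlim : ∀ j, Tendsto (fun q => w j * g q j) (𝓝[>] 0)
      (𝓝 (if j ∈ nearest T x then w j else 0)) := by
    intro j
    by_cases hj : j ∈ nearest T x
    · have : d j - d i₀ = 0 := sub_eq_zero.2 ((hnear j).1 hj)
      simp [hg, this, hj]
    · have hgt : 0 < d j - d i₀ :=
        sub_pos.2 (lt_of_le_of_ne (hi₀' j) fun h => hj ((hnear j).2 h.symm))
      have h1 : Tendsto (fun q : ℝ => q / (1 - q)) (𝓝[>] 0) (𝓝 0) := by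
        have : ContinuousAt (fun q : ℝ => q / (1 - q)) 0 :=
          continuousAt_id.div (continuousAt_const.sub continuousAt_id) (by norm_num)
        have h2 := this.tendsto
        simp only [zero_div] at h2
        exact h2.mono_left nhdsWithin_le_nhds
      have h2 := (h1.rpow_const (p := d j - d i₀) (Or.inr hgt.le)).const_mul (w j)
      rw [Real.zero_rpow hgt.ne', mul_zero] at h2
      simpa [hj] using h2
  have hq : ∀ᶠ q in 𝓝[>] (0 : ℝ), w i * g q i / ∑ j, w j * g q j = posterior w q T x i := by
    filter_upwards [Ioo_mem_nhdsGT (show (0 : ℝ) < 1 by norm_num)] with q hq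
    have hq1 : 0 < 1 - q := sub_pos.2 hq.2
    set C : ℝ := q ^ d i₀ * (1 - q) ^ ((n : ℝ) - d i₀) with hC
    have hCpos : 0 < C := mul_pos (Real.rpow_pos_of_pos hq.1 _) (Real.rpow_pos_of_pos hq1 _)
    have hl : ∀ j, w j * lik q (T j) x = w j * g q j * C := by
      intro j
      have e1 : q ^ d j = q ^ (d j - d i₀) * q ^ d i₀ := by
        rw [← Real.rpow_add hq.1]; congr 1; ring
      have e2 : (1 - q) ^ ((n : ℝ) - d i₀) =
          (1 - q) ^ (d j - d i₀) * (1 - q) ^ ((n : ℝ) - d j) := by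
        rw [← Real.rpow_add hq1]; congr 1; ring
      have e3 := (Real.rpow_pos_of_pos hq1 (d j - d i₀)).ne'
      change w j * (q ^ d j * (1 - q) ^ ((n : ℝ) - d j)) = _
      simp only [hg, hC]
      rw [Real.div_rpow hq.1.le hq1.le, e1, e2]
      field_simp
    have hSpos : 0 < ∑ j, w j * lik q (T j) x := by
      refine Finset.sum_pos (fun j _ => mul_pos (hw j) ?_) ⟨i, Finset.mem_univ i⟩
      exact mul_pos (Real.rpow_pos_of_pos hq.1 _) (Real.rpow_pos_of_pos hq1 _)
    unfold posterior
    rw [if_neg hSpos.ne']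
    simp only [hl, ← Finset.sum_mul]
    rw [mul_div_mul_right _ _ hCpos.ne']
  rw [h0]
  refine Tendsto.congr' hq ?_
  have hS := tendsto_finsetSum Finset.univ fun j _ => hlim j
  rw [hsum] at hS
  exact (hlim i).div hS hpos.ne'

end Step

section Algorithm

variable {k l m n : ℕ}

/-- The initial templates `T_i^{(0)}`. -/
def T0 (x : Fin m → Fin n → ℝ) (init : Fin l → Fin m) : Fin l → Fin n → ℝ :=
  fun i => x (init i)

/-- The weights `w_i^{(1)}` after the first round. -/
def w1 (x : Fin m → Fin n → ℝ) (init : Fin l → Fin m) (q₀ : ℝ) : Fin l → ℝ :=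
  emWeight (fun _ => 1 / (l : ℝ)) q₀ (T0 x init) x

/-- The templates `T_i^{(1)}` after the first round. -/
def T1 (x : Fin m → Fin n → ℝ) (init : Fin l → Fin m) (q₀ : ℝ) : Fin l → Fin n → ℝ :=
  emTemplate (fun _ => 1 / (l : ℝ)) q₀ (T0 x init) x

/-- The noise estimate `q₀ ≤ 1/2` with
`q₀ (1 - q₀) = (1 / (2 n)) * min_{i ≠ j} D(T_i^{(0)}, T_j^{(0)})`. -/
def IsNoiseEstimate (x : Fin m → Fin n → ℝ) (init : Fin l → Fin m) (q₀ : ℝ) : Prop :=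
  0 ≤ q₀ ∧ q₀ ≤ 1 / 2 ∧
    IsLeast {a : ℝ | ∃ i j, i ≠ j ∧ a = 1 / (2 * (n : ℝ)) * D (T0 x init i) (T0 x init j)}
      (q₀ * (1 - q₀))

/-- First pruning stage: the templates of weight at least `w_T = 1 / (4 l)`. -/
def Survives (x : Fin m → Fin n → ℝ) (init : Fin l → Fin m) (q₀ : ℝ) (i : Fin l) : Prop :=
  1 / (4 * (l : ℝ)) ≤ w1 x init q₀ i

/-- Second pruning stage: `sel 0, sel 1, …, sel (k - 1)` are distinct surviving indices, the first
one arbitrary, and each later one maximizing, among the surviving indices not yet selected, the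
minimum distance of its template to the templates selected before. -/
def IsSelection (x : Fin m → Fin n → ℝ) (init : Fin l → Fin m) (q₀ : ℝ) (sel : Fin k → Fin l) :
    Prop :=
  Function.Injective sel ∧ (∀ r, Survives x init q₀ (sel r)) ∧
    ∀ r i, (∃ s, s < r) → Survives x init q₀ i → (∀ s < r, sel s ≠ i) →
      (⨅ s : Set.Iio r, D (T1 x init q₀ i) (T1 x init q₀ (sel s))) ≤
        ⨅ s : Set.Iio r, D (T1 x init q₀ (sel r)) (T1 x init q₀ (sel s))

/-- `(q₀, sel)` are the noise estimate and the outcome of the pruning in a possible run of the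
two-round EM algorithm on the examples `x` with the initial examples `init`. -/
def IsRun (x : Fin m → Fin n → ℝ) (init : Fin l → Fin m) (q₀ : ℝ) (sel : Fin k → Fin l) :
    Prop :=
  IsNoiseEstimate x init q₀ ∧ IsSelection x init q₀ sel

/-- The weights `w_r^{(2)}` after the second round. -/
def w2 (x : Fin m → Fin n → ℝ) (init : Fin l → Fin m) (q₀ : ℝ) (sel : Fin k → Fin l) :
    Fin k → ℝ :=
  emWeight (fun _ => 1 / (k : ℝ)) q₀ (fun r => T1 x init q₀ (sel r)) x

/-- The templates `T_r^{(2)}` after the second round. -/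
def T2 (x : Fin m → Fin n → ℝ) (init : Fin l → Fin m) (q₀ : ℝ) (sel : Fin k → Fin l) :
    Fin k → Fin n → ℝ :=
  emTemplate (fun _ => 1 / (k : ℝ)) q₀ (fun r => T1 x init q₀ (sel r)) x

/-- `mean(S_i)`, the mean of the examples whose label is `i`. -/
def clusterMean (z : Fin m → Fin k) (x : Fin m → Fin n → ℝ) (i : Fin k) : Fin n → ℝ :=
  (1 / ((Finset.univ.filter fun j => z j = i).card : ℝ)) •
    ∑ j ∈ Finset.univ.filter (fun j => z j = i), x j

/-- The algorithm can be run, and whatever first template and whatever ties the second pruning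
stage picks, the outcome is good: exactly one selected template was initialized in each cluster
`S_i`, and, indexed accordingly, the final templates satisfy
`D(T_i^{(2)}, P_i) ≤ D(mean(S_i), P_i) + err`. -/
def Succeeds (P : Fin k → Fin n → Bool) (err : ℝ) (z : Fin m → Fin k) (y : Fin m → Fin n → Bool)
    (init : Fin l → Fin m) : Prop :=
  let x : Fin m → Fin n → ℝ := fun j => vec (y j)
  (∃ q₀, ∃ sel : Fin k → Fin l, IsRun x init q₀ sel) ∧
  ∀ q₀, ∀ sel : Fin k → Fin l, IsRun x init q₀ sel →
    ∃ π : Equiv.Perm (Fin k), ∀ i,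
      z (init (sel (π i))) = i ∧
      0 < w2 x init q₀ sel (π i) ∧
      D (T2 x init q₀ sel (π i)) (vec (P i)) ≤ D (clusterMean z x i) (vec (P i)) + err

end Algorithm

/-- `B = (1/2) (1 - 2q) ln (1 / ((1 - q) (4q + √q)))`. -/
def B (q : ℝ) : ℝ := 1 / 2 * (1 - 2 * q) * Real.log (1 / ((1 - q) * (4 * q + √q)))

/-- The constant `E`. -/
def E (q c : ℝ) (l n : ℕ) : ℝ :=
  min (1 / 4) (min
    ((c * (1 - 2 * q) ^ 2 / 2) / (c * (1 - 2 * q) ^ 2 + 2 * (1 - q) * (q + √q)))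
    ((3 * c * (1 - 2 * q) / 4 - 2 * q - 4 * √(6 * q * l / n)) / (c * (1 - 2 * q) + q + √q)))

end BernoulliEM

end

/-! The proof separates a deterministic analysis of EM from a probabilistic one.

Deterministic part (`succeeds_of_concentrated`). Suppose examples with equal labels are within `u`,
examples with different labels are at least `v ≥ u + Δ` apart, and every label occurs among the
initial examples. The likelihood ratio of two templates is `q₀ / (1 - q₀)` to the power of the
difference of their distances, and `q₀ / (1 - q₀) ≤ 4 q₀ (1 - q₀) ≤ R`. Hence in round one an
example gives posterior at most `R ^ Δ` to a template initialized in another cluster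
(`posterior_le_rpow`). A template of weight at least `1 / (4 l)` is therefore an average over its
own cluster, up to a contamination `κ = 4 l R ^ Δ`. Because no cluster is heavily over-represented
among the initial examples, each cluster keeps a surviving template.

Averaging cancels noise, so averaged templates can be much closer to each other than examples are.
Their separation is therefore measured by `signedGap`, which is linear in the difference of the
templates and bounded by `D`. It shows that surviving templates of different clusters are farther
apart than those of the same cluster, so farthest-first selection takes one per cluster
(`farthest_first_injective`). Round two repeats the posterior estimate with exponent `Δ - 2 κ n`.
The posteriors are then nearly the label indicators, and since the distance to a binary vector is
affine on mixtures, each new template is almost as close to its `P i` as the cluster mean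
(`D_emTemplate_le`).

Probabilistic part. Given the labels and the initial indices, the noise is an array of independent
bits (`map_joint`). Chernoff bounds with failure probability `exp (-(n * L))` per pair of examples
give `u`, `v` and the signed gap; Chernoff bounds for label counts give the cluster sizes and the
balance. The bound `R = (1 - q) (4 q + √q)` comes from Chebyshev's inequality for a pair of initial
examples of one cluster; two disjoint such pairs exist by pigeonhole, which squares the failure
probability. A union bound finishes. -/

namespace BernoulliEM

/-! ### Distances between mixtures of binary vectors -/

section Distance

variable {n : ℕ}

lemma D_nonneg (u v : Fin n → ℝ) : 0 ≤ D u v := Finset.sum_nonneg fun _ _ => abs_nonneg _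

lemma D_comm (u v : Fin n → ℝ) : D u v = D v u :=
  Finset.sum_congr rfl fun _ _ => abs_sub_comm _ _

lemma D_self (u : Fin n → ℝ) : D u u = 0 := by simp [D]

lemma abs_vec_sub_vec_le_one (y y' : Fin n → Bool) (s : Fin n) : |vec y s - vec y' s| ≤ 1 := by
  unfold vec; split_ifs <;> norm_num

lemma D_vec_le (y y' : Fin n → Bool) : D (vec y) (vec y') ≤ n := by
  calc D (vec y) (vec y') ≤ ∑ _s : Fin n, (1 : ℝ) :=
        Finset.sum_le_sum fun s _ => abs_vec_sub_vec_le_one y y' s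
    _ = n := by simp

/-- The distance from a binary vector is affine on mixtures of binary vectors. -/
lemma D_vec_mixture {ι : Type*} [Fintype ι] (α : ι → ℝ) (h1 : ∑ j, α j = 1) (h0 : ∀ j, 0 ≤ α j)
    (y : Fin n → Bool) (x : ι → Fin n → Bool) :
    D (vec y) (∑ j, α j • vec (x j)) = ∑ j, α j * D (vec y) (vec (x j)) := by
  unfold D
  simp only [Finset.mul_sum]
  rw [Finset.sum_comm]
  refine Finset.sum_congr rfl fun s _ => ?_
  simp only [Finset.sum_apply, Pi.smul_apply, smul_eq_mul]
  by_cases hy : y s = true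
  · have e : vec y s - ∑ j, α j * vec (x j) s = ∑ j, α j * (1 - vec (x j) s) := by
      simp [vec, hy, mul_sub, Finset.sum_sub_distrib, h1]
    have h : ∀ j, 0 ≤ 1 - vec (x j) s := fun j => by unfold vec; split_ifs <;> norm_num
    rw [e, abs_of_nonneg (Finset.sum_nonneg fun j _ => mul_nonneg (h0 j) (h j))]
    refine Finset.sum_congr rfl fun j _ => ?_
    rw [show vec y s = 1 by simp [vec, hy], abs_of_nonneg (h j)]
  · have h : ∀ j, 0 ≤ vec (x j) s := fun j => by unfold vec; split_ifs <;> norm_num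
    rw [show vec y s = 0 by simp [vec, hy], zero_sub, abs_neg,
      abs_of_nonneg (Finset.sum_nonneg fun j _ => mul_nonneg (h0 j) (h j))]
    refine Finset.sum_congr rfl fun j _ => ?_
    rw [zero_sub, abs_neg, abs_of_nonneg (h j)]

lemma mixture_sub_mixture {ι : Type*} [Fintype ι] (α β : ι → ℝ) (hα : ∑ j, α j = 1)
    (hβ : ∑ j, β j = 1) (x : ι → Fin n → ℝ) (s : Fin n) :
    (∑ j, α j • x j) s - (∑ j, β j • x j) s =
      ∑ j, ∑ j', α j * β j' * (x j s - x j' s) := by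
  simp only [Finset.sum_apply, Pi.smul_apply, smul_eq_mul, mul_sub, Finset.sum_sub_distrib]
  congr 1
  · refine Finset.sum_congr rfl fun j _ => ?_
    rw [← Finset.sum_mul, ← Finset.mul_sum, hβ, mul_one]
  · rw [Finset.sum_comm]
    refine Finset.sum_congr rfl fun j _ => ?_
    rw [← Finset.sum_mul, ← Finset.sum_mul, hα, one_mul]

lemma D_mixture_le {ι : Type*} [Fintype ι] (α β : ι → ℝ) (hα : ∑ j, α j = 1)
    (hβ : ∑ j, β j = 1) (hα0 : ∀ j, 0 ≤ α j) (hβ0 : ∀ j, 0 ≤ β j) (x : ι → Fin n → ℝ) :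
    D (∑ j, α j • x j) (∑ j, β j • x j) ≤ ∑ j, ∑ j', α j * β j' * D (x j) (x j') := by
  unfold D
  simp only [mixture_sub_mixture α β hα hβ]
  have : ∑ j, ∑ j', α j * β j' * ∑ s, |x j s - x j' s| =
      ∑ s, ∑ j, ∑ j', |α j * β j' * (x j s - x j' s)| := by
    rw [Finset.sum_comm]
    simp only [Finset.mul_sum]
    rw [Finset.sum_comm]
    rw [Finset.sum_comm (s := (Finset.univ : Finset (Fin n)))]
    refine Finset.sum_congr rfl fun j _ => ?_
    rw [Finset.sum_comm (s := (Finset.univ : Finset (Fin n)))]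
    refine Finset.sum_congr rfl fun j' _ => Finset.sum_congr rfl fun s _ => ?_
    rw [abs_mul, abs_of_nonneg (mul_nonneg (hα0 j) (hβ0 j'))]
  rw [this]
  refine Finset.sum_le_sum fun s _ => (Finset.abs_sum_le_sum_abs _ _).trans ?_
  exact Finset.sum_le_sum fun j _ => Finset.abs_sum_le_sum_abs _ _

/-- The component of `u - v` along `a - b`. -/
def signedGap (a b u v : Fin n → ℝ) : ℝ := ∑ s, (a s - b s) * (u s - v s)

lemma signedGap_le_D (y y' : Fin n → Bool) (u v : Fin n → ℝ) :
    |signedGap (vec y) (vec y') u v| ≤ D u v := by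
  refine (Finset.abs_sum_le_sum_abs _ _).trans (Finset.sum_le_sum fun s _ => ?_)
  rw [abs_mul]
  exact mul_le_of_le_one_left (abs_nonneg _) (abs_vec_sub_vec_le_one y y' s)

/-- Linearity is the reason for introducing `signedGap`: a lower bound for pairs of examples
survives averaging, which fails for `D`. -/
lemma signedGap_mixture {ι : Type*} [Fintype ι] (a b : Fin n → ℝ) (α β : ι → ℝ)
    (hα : ∑ j, α j = 1) (hβ : ∑ j, β j = 1) (x : ι → Fin n → ℝ) :
    signedGap a b (∑ j, α j • x j) (∑ j, β j • x j) =
      ∑ j, ∑ j', α j * β j' * signedGap a b (x j) (x j') := by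
  unfold signedGap
  simp only [mixture_sub_mixture α β hα hβ, Finset.mul_sum]
  rw [Finset.sum_comm]
  refine Finset.sum_congr rfl fun j _ => ?_
  rw [Finset.sum_comm]
  refine Finset.sum_congr rfl fun j' _ => Finset.sum_congr rfl fun s _ => ?_
  ring

end Distance

/-! ### Decay of posterior probabilities with the distance -/

section Posterior

variable {ι : Type*} [Fintype ι] {n : ℕ}

lemma lik_pos {q : ℝ} (hq : 0 < q) (hq1 : q < 1) (T x : Fin n → ℝ) : 0 < lik q T x :=
  mul_pos (Real.rpow_pos_of_pos hq _) (Real.rpow_pos_of_pos (sub_pos.2 hq1) _)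

lemma posterior_nonneg_of_nonneg {w : ι → ℝ} (hw : ∀ i, 0 ≤ w i) {q : ℝ} (hq : 0 ≤ q)
    (hq1 : q ≤ 1) (T : ι → Fin n → ℝ) (x : Fin n → ℝ) (i : ι) : 0 ≤ posterior w q T x i := by
  have hl : ∀ i, 0 ≤ lik q (T i) x := fun i =>
    mul_nonneg (Real.rpow_nonneg hq _) (Real.rpow_nonneg (sub_nonneg.2 hq1) _)
  unfold posterior
  split_ifs
  · exact div_nonneg (hw i) (Finset.sum_nonneg fun i _ => hw i)
  · simp
  · exact div_nonneg (mul_nonneg (hw i) (hl i))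
      (Finset.sum_nonneg fun i _ => mul_nonneg (hw i) (hl i))

lemma posterior_sum [Nonempty ι] {w : ι → ℝ} (hw : ∀ i, 0 < w i) (q : ℝ) (T : ι → Fin n → ℝ)
    (x : Fin n → ℝ) : ∑ i, posterior w q T x i = 1 := by
  classical
  unfold posterior
  split_ifs with h
  · rw [← Finset.sum_div, ← Finset.sum_filter, Finset.filter_mem_eq_inter, Finset.univ_inter]
    obtain ⟨i₀, -, hi₀⟩ := Finset.exists_min_image Finset.univ (fun j => D x (T j))
      Finset.univ_nonempty
    refine div_self (Finset.sum_pos (fun i _ => hw i) ⟨i₀, ?_⟩).ne'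
    simp only [nearest, Finset.mem_filter, Finset.mem_univ, true_and]
    exact fun j => hi₀ j (Finset.mem_univ j)
  · rw [← Finset.sum_div, div_self h]

/-- The posterior is at most the likelihood ratio of `T i` to `T i₀`, because the denominator
contains the term of `i₀`. -/
lemma posterior_le_rpow_of_pos {w₀ : ℝ} (hw : 0 < w₀) {q : ℝ} (hq : 0 < q) (hq1 : q ≤ 1 / 2)
    {R Δ : ℝ} (hR : 4 * (q * (1 - q)) ≤ R) (hΔ : 0 < Δ)
    (T : ι → Fin n → ℝ) (x : Fin n → ℝ) (i i₀ : ι) (h : D x (T i₀) + Δ ≤ D x (T i)) :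
    posterior (fun _ => w₀) q T x i ≤ R ^ Δ := by
  have hq1' : q < 1 := by linarith
  have h1q : 0 < 1 - q := by linarith
  have hS : 0 < ∑ i', w₀ * lik q (T i') x :=
    Finset.sum_pos (fun j _ => mul_pos hw (lik_pos hq hq1' _ _)) ⟨i, Finset.mem_univ i⟩
  have hS' : w₀ * lik q (T i₀) x ≤ ∑ i', w₀ * lik q (T i') x :=
    Finset.single_le_sum (f := fun i' => w₀ * lik q (T i') x)
      (fun j _ => (mul_pos hw (lik_pos hq hq1' _ _)).le) (Finset.mem_univ i₀)
  unfold posterior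
  rw [if_neg hS.ne', div_le_iff₀ hS]
  -- `q / (1 - q) ≤ 4 q (1 - q)`, since `1 - q ≥ 1 / 2`.
  have hρ : q / (1 - q) ≤ R := by
    refine le_trans ?_ hR
    rw [div_le_iff₀ h1q]
    nlinarith [mul_nonneg hq.le (sq_nonneg (1 - 2 * q)), mul_nonneg hq.le h1q.le,
      mul_nonneg (mul_nonneg hq.le (show 0 ≤ 1 - 2 * q by linarith))
        (show 0 ≤ 3 - 2 * q by linarith)]
  have hρ0 : 0 < q / (1 - q) := div_pos hq h1q
  have hρ1 : q / (1 - q) ≤ 1 := by rw [div_le_one h1q]; linarith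
  have hlik : lik q (T i) x = (q / (1 - q)) ^ (D x (T i) - D x (T i₀)) * lik q (T i₀) x := by
    unfold lik
    rw [Real.div_rpow hq.le h1q.le]
    have e1 : q ^ D x (T i) = q ^ (D x (T i) - D x (T i₀)) * q ^ D x (T i₀) := by
      rw [← Real.rpow_add hq]; congr 1; ring
    have e2 : (1 - q) ^ ((n : ℝ) - D x (T i₀)) =
        (1 - q) ^ (D x (T i) - D x (T i₀)) * (1 - q) ^ ((n : ℝ) - D x (T i)) := by
      rw [← Real.rpow_add h1q]; congr 1; ring
    rw [e1, e2]
    have := (Real.rpow_pos_of_pos h1q (D x (T i) - D x (T i₀))).ne'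
    field_simp
  have hpow : (q / (1 - q)) ^ (D x (T i) - D x (T i₀)) ≤ R ^ Δ :=
    (Real.rpow_le_rpow_of_exponent_ge hρ0 hρ1 (by linarith)).trans
      (Real.rpow_le_rpow hρ0.le hρ hΔ.le)
  calc w₀ * lik q (T i) x
      = (q / (1 - q)) ^ (D x (T i) - D x (T i₀)) * (w₀ * lik q (T i₀) x) := by rw [hlik]; ring
    _ ≤ R ^ Δ * (w₀ * lik q (T i₀) x) :=
        mul_le_mul_of_nonneg_right hpow (mul_pos hw (lik_pos hq hq1' _ _)).le
    _ ≤ R ^ Δ * ∑ i', w₀ * lik q (T i') x :=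
        mul_le_mul_of_nonneg_left hS' (Real.rpow_nonneg (hρ0.le.trans hρ) _)

/-- A template that is farther away than another one by `Δ` has small posterior probability. -/
lemma posterior_le_rpow {w₀ : ℝ} (hw : 0 < w₀) {q : ℝ} (hq : 0 ≤ q) (hq1 : q ≤ 1 / 2)
    {R Δ : ℝ} (hR0 : 0 < R) (hR : 4 * (q * (1 - q)) ≤ R) (hΔ : 0 < Δ)
    (T : ι → Fin n → ℝ) (x : Fin n → ℝ) (i i₀ : ι) (h : D x (T i₀) + Δ ≤ D x (T i)) :
    posterior (fun _ => w₀) q T x i ≤ R ^ Δ := by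
  rcases hq.eq_or_lt with rfl | hq
  -- At `q = 0` the bound is obtained as a limit; `R > 0` leaves room for small positive noise
  -- levels.
  · refine le_of_tendsto (tendsto_posterior (fun _ : ι => w₀) (fun _ => hw) T x i) ?_
    filter_upwards [Ioo_mem_nhdsGT (show (0 : ℝ) < min (1 / 2) (R / 4) by positivity)] with q hq
    have h1 := hq.2.trans_le (min_le_left _ _)
    have h2 := hq.2.trans_le (min_le_right _ _)
    refine posterior_le_rpow_of_pos hw hq.1 h1.le ?_ hΔ T x i i₀ h
    nlinarith [sq_nonneg q]
  · exact posterior_le_rpow_of_pos hw hq hq1 hR hΔ T x i i₀ h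

end Posterior

/-! ### Farthest-first selection -/

section FarthestFirst

variable {k l : ℕ}

/-- Farthest-first traversal of `k` elements exists if at least `k` candidates are available. -/
lemma exists_farthest_first (Sv : Fin l → Prop) (d : Fin l → Fin l → ℝ)
    (f : Fin k → Fin l) (hf : Function.Injective f) (hfS : ∀ a, Sv (f a)) :
    ∃ sel : Fin k → Fin l, Function.Injective sel ∧ (∀ r, Sv (sel r)) ∧
      ∀ r i, (∃ s, s < r) → Sv i → (∀ s < r, sel s ≠ i) →
        (⨅ s : Set.Iio r, d i (sel s)) ≤ ⨅ s : Set.Iio r, d (sel r) (sel s) := by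
  classical
  have key : ∀ t : ℕ, t ≤ k → ∃ sel : Fin k → Fin l,
      (∀ r s : Fin k, r.1 < t → s.1 < t → sel r = sel s → r = s) ∧
      (∀ r : Fin k, r.1 < t → Sv (sel r)) ∧
      ∀ r : Fin k, r.1 < t → ∀ i, Sv i → (∀ s < r, sel s ≠ i) →
        (⨅ s : Set.Iio r, d i (sel s)) ≤ ⨅ s : Set.Iio r, d (sel r) (sel s) := by
    intro t
    induction t with
    | zero => exact fun _ => ⟨f, by simp, by simp, by simp⟩
    | succ t ih =>
      intro ht
      obtain ⟨sel, h1, h2, h3⟩ := ih (by omega)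
      set t' : Fin k := ⟨t, by omega⟩ with ht'
      set C : Finset (Fin l) :=
        Finset.univ.filter fun i => Sv i ∧ ∀ s : Fin k, s < t' → sel s ≠ i with hC
      have hCne : C.Nonempty := by
        by_contra hne
        rw [Finset.not_nonempty_iff_eq_empty] at hne
        -- Without a remaining candidate, the `k` distinct values of `f` would lie among the `t < k`
        -- elements already selected.
        have hsub : Finset.univ.image f ⊆ (Finset.Iio t').image sel := by
          intro i hi
          obtain ⟨a, -, rfl⟩ := Finset.mem_image.1 hi
          by_contra hnot
          have : f a ∈ C := by
            simp only [hC, Finset.mem_filter, Finset.mem_univ, true_and]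
            exact ⟨hfS a, fun s hs he => hnot (Finset.mem_image.2 ⟨s, by simpa using hs, he⟩)⟩
          simp [hne] at this
        have := (Finset.card_le_card hsub).trans Finset.card_image_le
        rw [Finset.card_image_of_injective _ hf] at this
        simp [ht'] at this
        omega
      obtain ⟨i₀, hi₀, hmax⟩ := Finset.exists_max_image C
        (fun i => ⨅ s : Set.Iio t', d i (sel s)) hCne
      simp only [hC, Finset.mem_filter, Finset.mem_univ, true_and] at hi₀ hmax
      have hne : ∀ s : Fin k, s.1 < t → Function.update sel t' i₀ s = sel s := fun s hs =>
        Function.update_of_ne (by rintro rfl; simp [ht'] at hs) _ _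
      have heq : Function.update sel t' i₀ t' = i₀ := Function.update_self _ _ _
      have hcase : ∀ s : Fin k, s.1 < t + 1 → s.1 < t ∨ s = t' := fun s hs => by
        rcases Nat.lt_succ_iff_lt_or_eq.1 hs with h | h
        · exact Or.inl h
        · exact Or.inr (Fin.ext h)
      refine ⟨Function.update sel t' i₀, ?_, ?_, ?_⟩
      · intro r s hr hs
        rcases hcase r hr with hr | rfl <;> rcases hcase s hs with hs | rfl
        · rw [hne r hr, hne s hs]; exact h1 r s hr hs
        · rw [hne r hr, heq]; exact fun h => absurd h (hi₀.2 r hr)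
        · rw [hne s hs, heq]; exact fun h => absurd h.symm (hi₀.2 s hs)
        · exact fun _ => rfl
      · intro r hr
        rcases hcase r hr with hr | rfl
        · rw [hne r hr]; exact h2 r hr
        · rw [heq]; exact hi₀.1
      · intro r hr i hi hs
        have hlow : ∀ s : Fin k, s < r → Function.update sel t' i₀ s = sel s := fun s hs =>
          hne s (by have : s.1 < r.1 := hs; omega)
        have hinf : ∀ i', (⨅ s : Set.Iio r, d i' (Function.update sel t' i₀ s)) =
            ⨅ s : Set.Iio r, d i' (sel s) := fun i' =>
          iInf_congr fun s => by rw [hlow s s.2]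
        rw [hinf, hinf]
        have hs' : ∀ s < r, sel s ≠ i := fun s h => by rw [← hlow s h]; exact hs s h
        rcases hcase r hr with hr | rfl
        · rw [hne r hr]; exact h3 r hr i hi hs'
        · rw [heq]; exact hmax i ⟨hi, hs'⟩
  obtain ⟨sel, h1, h2, h3⟩ := key k le_rfl
  exact ⟨sel, fun r s => h1 r s r.2 s.2, fun r => h2 r r.2, fun r i _ => h3 r r.2 i⟩

/-- Farthest-first traversal picks one element per class if classes are well separated. -/
lemma farthest_first_injective (Sv : Fin l → Prop) (d : Fin l → Fin l → ℝ) (cls : Fin l → Fin k)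
    {α β : ℝ} (hαβ : α < β)
    (hsame : ∀ i i', Sv i → Sv i' → cls i = cls i' → d i i' ≤ α)
    (hdiff : ∀ i i', Sv i → Sv i' → cls i ≠ cls i' → β ≤ d i i')
    (hcls : ∀ a, ∃ i, Sv i ∧ cls i = a) (sel : Fin k → Fin l) (hS : ∀ r, Sv (sel r))
    (hsel : ∀ r i, (∃ s, s < r) → Sv i → (∀ s < r, sel s ≠ i) →
        (⨅ s : Set.Iio r, d i (sel s)) ≤ ⨅ s : Set.Iio r, d (sel r) (sel s)) :
    Function.Injective (cls ∘ sel) := by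
  classical
  have key : ∀ r s : Fin k, s < r → cls (sel s) ≠ cls (sel r) := by
    intro r s hs he
    -- Fewer than `k` elements precede `r`, so some class has not been met.
    obtain ⟨a, ha⟩ : ∃ a, a ∉ (Finset.Iio r).image (cls ∘ sel) := by
      by_contra hall
      push Not at hall
      have h1 : (Finset.univ : Finset (Fin k)) ⊆ (Finset.Iio r).image (cls ∘ sel) :=
        fun a _ => hall a
      have := (Finset.card_le_card h1).trans Finset.card_image_le
      simp at this
      omega
    obtain ⟨i, hi, rfl⟩ := hcls a
    have hne : ∀ s < r, cls i ≠ cls (sel s) := fun s hs h =>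
      ha (Finset.mem_image.2 ⟨s, by simpa using hs, h.symm⟩)
    have h := hsel r i ⟨s, hs⟩ hi fun s hs h => hne s hs (by rw [h])
    have : Nonempty (Set.Iio r) := ⟨⟨s, hs⟩⟩
    -- A candidate of the unmet class is at least `β` from everything selected, whereas `sel r`
    -- would be within `α` of `sel s`.
    have h1 : β ≤ ⨅ s : Set.Iio r, d i (sel s) :=
      le_ciInf fun s => hdiff _ _ hi (hS s) (hne s s.2)
    have h2 : (⨅ s : Set.Iio r, d (sel r) (sel s)) ≤ α :=
      (ciInf_le (Set.finite_range _).bddBelow ⟨s, hs⟩).trans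
        (hsame _ _ (hS r) (hS s) he.symm)
    linarith
  intro r s h
  rcases lt_trichotomy r s with h' | h' | h'
  · exact absurd h (key s r h')
  · exact h'
  · exact absurd h.symm (key r s h')

end FarthestFirst

/-! ### Mixtures contaminated by examples of other clusters -/

section Mixture

variable {k n m : ℕ}

/-- `T` is a convex combination of the examples, with total weight at most `κ` on the examples
whose label is not `a`. -/
def IsClusterMixture (z : Fin m → Fin k) (y : Fin m → Fin n → Bool) (a : Fin k) (κ : ℝ)
    (T : Fin n → ℝ) : Prop :=
  ∃ α : Fin m → ℝ, (∀ j, 0 ≤ α j) ∧ ∑ j, α j = 1 ∧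
    ∑ j, α j * (if z j = a then 0 else 1) ≤ κ ∧ T = ∑ j, α j • vec (y j)

variable {z : Fin m → Fin k} {y : Fin m → Fin n → Bool} {κ : ℝ} {a b : Fin k}
  {T T' : Fin n → ℝ}

/-- Estimates for examples take the form "`A`, plus a penalty `C` for a wrong label"; in a mixture
the penalty is weighted by the contamination. -/
lemma sum_mul_add_indicator {α : Fin m → ℝ} (hα : ∑ j, α j = 1) (A C : ℝ) :
    ∑ j, α j * (A + C * (if z j = a then 0 else 1)) =
      A + C * ∑ j, α j * (if z j = a then 0 else 1) := by
  simp only [mul_add, Finset.sum_add_distrib, ← Finset.sum_mul, hα, Finset.mul_sum]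
  rw [one_mul]
  congr 1
  exact Finset.sum_congr rfl fun j _ => by ring

lemma sum_sum_mul_add_indicator {α β : Fin m → ℝ} (hα : ∑ j, α j = 1) (hβ : ∑ j, β j = 1)
    (A C : ℝ) :
    ∑ j, ∑ j', α j * β j' * (A + C * ((if z j = a then 0 else 1) + (if z j' = b then 0 else 1))) =
      A + C * (∑ j, α j * (if z j = a then 0 else 1) + ∑ j, β j * (if z j = b then 0 else 1)) := by
  have h : ∀ j, ∑ j', α j * β j' *
      (A + C * ((if z j = a then 0 else 1) + (if z j' = b then 0 else 1))) =
      α j * ((A + C * ∑ j, β j * (if z j = b then 0 else 1)) +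
        C * (if z j = a then 0 else 1)) := by
    intro j
    have := sum_mul_add_indicator (z := z) (a := b) hβ (A + C * (if z j = a then 0 else 1)) C
    rw [show (A + C * ∑ j, β j * (if z j = b then (0 : ℝ) else 1)) + C * (if z j = a then 0 else 1)
      = A + C * (if z j = a then 0 else 1) + C * ∑ j, β j * (if z j = b then (0 : ℝ) else 1) by
        ring, ← this, Finset.mul_sum]
    exact Finset.sum_congr rfl fun j' _ => by ring
  simp only [h]
  rw [sum_mul_add_indicator hα]
  ring

/-- Each wrong label in a pair costs at most `n`, the largest distance of binary vectors, and each
mixture has wrong labels with weight at most `κ`. -/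
lemma IsClusterMixture.D_le {u : ℝ} (hu : 0 ≤ u)
    (hsame : ∀ j j', z j = z j' → D (vec (y j)) (vec (y j')) ≤ u)
    (hT : IsClusterMixture z y a κ T) (hT' : IsClusterMixture z y a κ T') :
    D T T' ≤ u + 2 * κ * n := by
  obtain ⟨α, hα0, hα, hακ, rfl⟩ := hT
  obtain ⟨β, hβ0, hβ, hβκ, rfl⟩ := hT'
  refine (D_mixture_le α β hα hβ hα0 hβ0 _).trans ?_
  calc _ ≤ ∑ j, ∑ j', α j * β j' *
        (u + n * ((if z j = a then 0 else 1) + (if z j' = a then 0 else 1))) := by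
        refine Finset.sum_le_sum fun j _ => Finset.sum_le_sum fun j' _ =>
          mul_le_mul_of_nonneg_left ?_ (mul_nonneg (hα0 j) (hβ0 j'))
        have := D_vec_le (y j) (y j')
        have hn : (0 : ℝ) ≤ n := Nat.cast_nonneg n
        split_ifs with h1 h2 h2
        · simpa using hsame j j' (h1.trans h2.symm)
        all_goals linarith
    _ = u + n * (∑ j, α j * (if z j = a then 0 else 1) +
          ∑ j, β j * (if z j = a then 0 else 1)) := sum_sum_mul_add_indicator hα hβ _ _
    _ ≤ u + n * (κ + κ) := by gcongr
    _ = _ := by ring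

/-- A wrong label can lower the signed gap from `g` to `-n`, hence by at most `2 n` as `g ≤ n`. The
direction `P a - P b` is fixed for all pairs of examples, so that linearity applies. -/
lemma IsClusterMixture.le_D {g : ℝ} {P : Fin k → Fin n → Bool} (hg : g ≤ n) (hab : a ≠ b)
    (hgap : ∀ j j', z j ≠ z j' →
      g ≤ signedGap (vec (P (z j))) (vec (P (z j'))) (vec (y j)) (vec (y j')))
    (hT : IsClusterMixture z y a κ T) (hT' : IsClusterMixture z y b κ T') :
    g - 4 * κ * n ≤ D T T' := by
  obtain ⟨α, hα0, hα, hακ, rfl⟩ := hT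
  obtain ⟨β, hβ0, hβ, hβκ, rfl⟩ := hT'
  refine le_trans ?_ ((le_abs_self _).trans (signedGap_le_D (P a) (P b) _ _))
  rw [signedGap_mixture _ _ α β hα hβ]
  calc g - 4 * κ * n = g + (-(2 * n)) * (κ + κ) := by ring
    _ ≤ g + (-(2 * n)) * (∑ j, α j * (if z j = a then 0 else 1) +
          ∑ j, β j * (if z j = b then 0 else 1)) := by
        have hn : (0 : ℝ) ≤ n := Nat.cast_nonneg n
        nlinarith
    _ = ∑ j, ∑ j', α j * β j' *
        (g + (-(2 * n)) * ((if z j = a then 0 else 1) + (if z j' = b then 0 else 1))) :=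
        (sum_sum_mul_add_indicator hα hβ _ _).symm
    _ ≤ _ := by
        refine Finset.sum_le_sum fun j _ => Finset.sum_le_sum fun j' _ =>
          mul_le_mul_of_nonneg_left ?_ (mul_nonneg (hα0 j) (hβ0 j'))
        have h1 := (signedGap_le_D (P a) (P b) (vec (y j)) (vec (y j'))).trans (D_vec_le _ _)
        have h2 := (abs_le.1 h1).1
        have hn : (0 : ℝ) ≤ n := Nat.cast_nonneg n
        split_ifs with h3 h4 h4
        · subst h3; subst h4; simpa using hgap j j' hab
        all_goals linarith

lemma IsClusterMixture.D_example_le {u : ℝ} (hu : 0 ≤ u)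
    (hsame : ∀ j j', z j = z j' → D (vec (y j)) (vec (y j')) ≤ u)
    (hT : IsClusterMixture z y a κ T) {j : Fin m} (hj : z j = a) :
    D (vec (y j)) T ≤ u + κ * n := by
  obtain ⟨α, hα0, hα, hακ, rfl⟩ := hT
  rw [D_vec_mixture α hα hα0]
  calc _ ≤ ∑ j', α j' * (u + n * (if z j' = a then 0 else 1)) := by
        refine Finset.sum_le_sum fun j' _ => mul_le_mul_of_nonneg_left ?_ (hα0 j')
        have := D_vec_le (y j) (y j')
        split_ifs with h1
        · simpa using hsame j j' (hj.trans h1.symm)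
        · linarith
    _ = u + n * ∑ j, α j * (if z j = a then 0 else 1) := sum_mul_add_indicator hα _ _
    _ ≤ u + n * κ := by gcongr
    _ = _ := by ring

lemma IsClusterMixture.le_D_example {v : ℝ} (hv : v ≤ n)
    (hdiff : ∀ j j', z j ≠ z j' → v ≤ D (vec (y j)) (vec (y j')))
    (hT : IsClusterMixture z y a κ T) {j : Fin m} (hj : z j ≠ a) :
    v - κ * n ≤ D (vec (y j)) T := by
  obtain ⟨α, hα0, hα, hακ, rfl⟩ := hT
  rw [D_vec_mixture α hα hα0]
  calc v - κ * n = v + (-n) * κ := by ring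
    _ ≤ v + (-n) * ∑ j, α j * (if z j = a then 0 else 1) := by
        have hn : (0 : ℝ) ≤ n := Nat.cast_nonneg n
        nlinarith
    _ = ∑ j', α j' * (v + (-n) * (if z j' = a then 0 else 1)) :=
        (sum_mul_add_indicator hα _ _).symm
    _ ≤ _ := by
        refine Finset.sum_le_sum fun j' _ => mul_le_mul_of_nonneg_left ?_ (hα0 j')
        have := D_nonneg (vec (y j)) (vec (y j'))
        split_ifs with h1
        · simpa using hdiff j j' (fun h => hj (h.trans h1))
        · linarith

end Mixture

/-! ### One EM step under posterior bounds -/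

section Step

variable {k n m : ℕ} {ι : Type*} [Fintype ι] {w : ι → ℝ} {q : ℝ} {T : ι → Fin n → ℝ}

lemma emWeight_mul (hm : 0 < m) (x : Fin m → Fin n → ℝ) (i : ι) :
    m * emWeight w q T x i = ∑ j, posterior w q T (x j) i := by
  have : (m : ℝ) ≠ 0 := by positivity
  unfold emWeight
  field_simp

lemma emTemplate_eq_mixture (hm : 0 < m) (x : Fin m → Fin n → ℝ) (i : ι) :
    emTemplate w q T x i =
      ∑ j, (posterior w q T (x j) i / ∑ j, posterior w q T (x j) i) • x j := by
  unfold emTemplate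
  rw [emWeight_mul hm, Finset.smul_sum]
  refine Finset.sum_congr rfl fun j _ => ?_
  rw [smul_smul]; congr 1; ring

/-- The template after an EM step is mostly a mixture of examples with label `a` if the other
examples have small posterior probability. -/
lemma isClusterMixture_emTemplate (hw : ∀ i, 0 ≤ w i) (hq : 0 ≤ q) (hq1 : q ≤ 1) (hm : 0 < m)
    {z : Fin m → Fin k} {y : Fin m → Fin n → Bool} {a : Fin k} {i : ι} {θ η : ℝ} (hθ : 0 < θ)
    (hη : 0 ≤ η) (hi : θ ≤ emWeight w q T (fun j => vec (y j)) i)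
    (h : ∀ j, z j ≠ a → posterior w q T (vec (y j)) i ≤ η) :
    IsClusterMixture z y a (η / θ) (emTemplate w q T (fun j => vec (y j)) i) := by
  have hm' : (0 : ℝ) < m := by exact_mod_cast hm
  have hS := emWeight_mul (w := w) (q := q) (T := T) hm (fun j => vec (y j)) i
  have hSpos : m * θ ≤ ∑ j, posterior w q T (vec (y j)) i := by rw [← hS]; gcongr
  have hS0 : 0 < ∑ j, posterior w q T (vec (y j)) i := (mul_pos hm' hθ).trans_le hSpos
  refine ⟨_, fun j => ?_, ?_, ?_, emTemplate_eq_mixture hm _ _⟩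
  · exact div_nonneg (posterior_nonneg_of_nonneg hw hq hq1 _ _ _) hS0.le
  · rw [← Finset.sum_div, div_self hS0.ne']
  · simp only [div_mul_eq_mul_div, ← Finset.sum_div]
    rw [div_le_div_iff₀ hS0 hθ]
    have : ∑ j, posterior w q T (vec (y j)) i * (if z j = a then 0 else 1) ≤ ∑ _j : Fin m, η := by
      refine Finset.sum_le_sum fun j _ => ?_
      split_ifs with hj
      · simpa using hη
      · simpa using h j hj
    simp only [Finset.sum_const, Finset.card_univ, Fintype.card_fin, nsmul_eq_mul] at this
    calc _ ≤ m * η * θ := by gcongr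
      _ = η * (m * θ) := by ring
      _ ≤ _ := by gcongr

lemma card_filter_mul_le_sum (z : Fin m → Fin k) (a : Fin k) (p : Fin m → ℝ) (hp : ∀ j, 0 ≤ p j)
    {r : ℝ} (h : ∀ j, z j = a → r ≤ p j) :
    ((Finset.univ.filter fun j => z j = a).card : ℝ) * r ≤ ∑ j, p j := by
  calc _ = ∑ _j ∈ Finset.univ.filter (fun j => z j = a), r := by simp
    _ ≤ ∑ j ∈ Finset.univ.filter (fun j => z j = a), p j :=
        Finset.sum_le_sum fun j hj => h j (by simpa using hj)
    _ ≤ _ := Finset.sum_le_sum_of_subset_of_nonneg (Finset.filter_subset _ _) fun j _ _ => hp j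

/-- If the posterior probabilities are nearly the indicator of the label `a`, then the new
template is nearly as good as the mean of the cluster. -/
lemma D_emTemplate_le (hw : ∀ i, 0 < w i) (hq : 0 ≤ q) (hq1 : q ≤ 1) (hm : 0 < m)
    {z : Fin m → Fin k} {y : Fin m → Fin n → Bool} {a : Fin k} {i : ι} {ρ η : ℝ}
    (hη : 0 ≤ η) (hρ1 : ρ < 1)
    (hS : 0 < (Finset.univ.filter fun j => z j = a).card)
    (h : ∀ j, z j ≠ a → posterior w q T (vec (y j)) i ≤ η)
    (h' : ∀ j, z j = a → 1 - ρ ≤ posterior w q T (vec (y j)) i) (p : Fin n → Bool) :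
    0 < emWeight w q T (fun j => vec (y j)) i ∧
    D (clusterMean z (fun j => vec (y j)) a) (vec p) ≤ n ∧
    (1 - ρ) * D (emTemplate w q T (fun j => vec (y j)) i) (vec p) ≤
      D (clusterMean z (fun j => vec (y j)) a) (vec p) +
        m / ((Finset.univ.filter fun j => z j = a).card : ℝ) * η * n := by
  classical
  set S : ℝ := ((Finset.univ.filter fun j => z j = a).card : ℝ) with hSdef
  have hS0 : 0 < S := by simpa [hSdef] using hS
  set f : Fin m → ℝ := fun j => posterior w q T (vec (y j)) i with hf
  have hf0 : ∀ j, 0 ≤ f j := fun j => posterior_nonneg_of_nonneg (fun i => (hw i).le) hq hq1 _ _ _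
  have hf1 : ∀ j, f j ≤ 1 := fun j => by
    have : Nonempty ι := ⟨i⟩
    rw [← posterior_sum hw q T (vec (y j))]
    exact Finset.single_le_sum (f := fun i => posterior w q T (vec (y j)) i)
      (fun i _ => posterior_nonneg_of_nonneg (fun i => (hw i).le) hq hq1 _ _ _)
      (Finset.mem_univ i)
  have hF : S * (1 - ρ) ≤ ∑ j, f j := card_filter_mul_le_sum z a f hf0 h'
  have hF0 : 0 < ∑ j, f j := (mul_pos hS0 (by linarith)).trans_le hF
  constructor
  · have := emWeight_mul (w := w) (q := q) (T := T) hm (fun j => vec (y j)) i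
    have hm' : (0 : ℝ) < m := by exact_mod_cast hm
    refine pos_of_mul_pos_right (a := (m : ℝ)) ?_ hm'.le
    rw [this]; exact hF0
  have e1 : D (emTemplate w q T (fun j => vec (y j)) i) (vec p) =
      (∑ j, f j * D (vec p) (vec (y j))) / ∑ j, f j := by
    rw [emTemplate_eq_mixture hm, D_comm, D_vec_mixture]
    · simp only [div_mul_eq_mul_div, ← Finset.sum_div]; rfl
    · rw [← Finset.sum_div]; exact div_self hF0.ne'
    · exact fun j => div_nonneg (hf0 j) hF0.le
  have e2 : D (clusterMean z (fun j => vec (y j)) a) (vec p) =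
      (∑ j ∈ Finset.univ.filter (fun j => z j = a), D (vec p) (vec (y j))) / S := by
    have : clusterMean z (fun j => vec (y j)) a =
        ∑ j, (if z j = a then 1 / S else 0) • vec (y j) := by
      unfold clusterMean
      rw [Finset.smul_sum, Finset.sum_filter]
      refine Finset.sum_congr rfl fun j _ => ?_
      split_ifs <;> simp [hSdef]
    rw [this, D_comm, D_vec_mixture]
    · rw [Finset.sum_filter, Finset.sum_div]
      refine Finset.sum_congr rfl fun j _ => ?_
      split_ifs <;> ring
    · rw [← Finset.sum_filter, Finset.sum_const, nsmul_eq_mul, ← hSdef]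
      field_simp
    · intro j; split_ifs <;> positivity
  -- The posterior is at most `1` on the cluster and at most `η` off it.
  have e3 : ∑ j, f j * D (vec p) (vec (y j)) ≤
      ∑ j ∈ Finset.univ.filter (fun j => z j = a), D (vec p) (vec (y j)) + m * η * n := by
    calc _ ≤ ∑ j, ((if z j = a then D (vec p) (vec (y j)) else 0) + η * n) := by
          refine Finset.sum_le_sum fun j _ => ?_
          have hD0 := D_nonneg (vec p) (vec (y j))
          have hD1 := D_vec_le p (y j)
          split_ifs with hj
          · have : f j * D (vec p) (vec (y j)) ≤ D (vec p) (vec (y j)) :=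
              mul_le_of_le_one_left hD0 (hf1 j)
            have : 0 ≤ η * n := by positivity
            linarith
          · rw [zero_add]
            exact mul_le_mul (h j hj) hD1 hD0 hη
      _ = _ := by
          rw [Finset.sum_add_distrib, ← Finset.sum_filter]; simp; ring
  have hD0 : 0 ≤ ∑ j, f j * D (vec p) (vec (y j)) :=
    Finset.sum_nonneg fun j _ => mul_nonneg (hf0 j) (D_nonneg _ _)
  rw [e1, e2]
  refine ⟨?_, ?_⟩
  · rw [div_le_iff₀ hS0]
    calc _ ≤ ∑ _j ∈ Finset.univ.filter (fun j => z j = a), (n : ℝ) :=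
          Finset.sum_le_sum fun j _ => D_vec_le p (y j)
      _ = n * S := by simp [hSdef, mul_comm]
  calc (1 - ρ) * ((∑ j, f j * D (vec p) (vec (y j))) / ∑ j, f j)
      ≤ (1 - ρ) * ((∑ j, f j * D (vec p) (vec (y j))) / (S * (1 - ρ))) := by
        refine mul_le_mul_of_nonneg_left ?_ (by linarith)
        exact div_le_div_of_nonneg_left hD0 (mul_pos hS0 (by linarith)) hF
    _ = (∑ j, f j * D (vec p) (vec (y j))) / S := by
        have : 1 - ρ ≠ 0 := by linarith
        field_simp
    _ ≤ (∑ j ∈ Finset.univ.filter (fun j => z j = a), D (vec p) (vec (y j)) + m * η * n) / S := by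
        gcongr
    _ = _ := by ring

end Step

section Round

variable {n m : ℕ} {ι : Type*} [Fintype ι]

-- Since posteriors sum to one, what is not on `S` is a sum of at most `Fintype.card ι` small terms.
-- This turns upper bounds for wrong templates into lower bounds for right ones.
open Classical in
lemma one_sub_le_sum_posterior [Nonempty ι] {w : ι → ℝ} (hw : ∀ i, 0 < w i) (q : ℝ)
    (T : ι → Fin n → ℝ) (x : Fin n → ℝ) (S : Finset ι) {η : ℝ} (hη : 0 ≤ η)
    (h : ∀ i, i ∉ S → posterior w q T x i ≤ η) :
    1 - Fintype.card ι * η ≤ ∑ i ∈ S, posterior w q T x i := by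
  have h1 := posterior_sum hw q T x
  rw [← Finset.sum_add_sum_compl S] at h1
  have h2 : ∑ i ∈ Sᶜ, posterior w q T x i ≤ ∑ _i ∈ Sᶜ, η :=
    Finset.sum_le_sum fun i hi => h i (by simpa using hi)
  rw [Finset.sum_const, nsmul_eq_mul] at h2
  have h3 : (Sᶜ.card : ℝ) * η ≤ Fintype.card ι * η := by
    gcongr; exact_mod_cast Finset.card_le_univ _
  linarith

end Round

/-! ### The noise estimate -/

section NoiseEstimate

variable {n m l : ℕ} {x : Fin m → Fin n → ℝ} {init : Fin l → Fin m} {R : ℝ}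

/-- A single close pair suffices, because `q₀` is defined by a minimum over pairs. -/
lemma IsNoiseEstimate.le {q₀ : ℝ} (hn : 0 < n) (h : IsNoiseEstimate x init q₀)
    (hR : ∃ i i', i ≠ i' ∧ D (T0 x init i) (T0 x init i') ≤ n * R / 2) :
    4 * (q₀ * (1 - q₀)) ≤ R := by
  obtain ⟨i, i', hne, hD⟩ := hR
  have hn' : (0 : ℝ) < n := by exact_mod_cast hn
  have h1 := h.2.2.2 ⟨i, i', hne, rfl⟩
  calc 4 * (q₀ * (1 - q₀)) ≤ 4 * (1 / (2 * (n : ℝ)) * (n * R / 2)) := by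
        refine mul_le_mul_of_nonneg_left (h1.trans ?_) (by norm_num)
        gcongr
    _ = R := by field_simp; ring

/-- With `R ≤ 1` a close pair puts the minimum below `1 / 4`, the maximum of `t (1 - t)`; the
smaller root of the quadratic then lies in `[0, 1/2]`. -/
lemma exists_isNoiseEstimate (hn : 0 < n) (hR1 : R ≤ 1)
    (hR : ∃ i i', i ≠ i' ∧ D (T0 x init i) (T0 x init i') ≤ n * R / 2) :
    ∃ q₀, IsNoiseEstimate x init q₀ := by
  obtain ⟨i, i', hne, hD⟩ := hR
  have hn' : (0 : ℝ) < n := by exact_mod_cast hn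
  obtain ⟨⟨i₁, i₂⟩, hi, hmin⟩ := Finset.exists_min_image
    (Finset.univ.filter fun p : Fin l × Fin l => p.1 ≠ p.2)
    (fun p => 1 / (2 * (n : ℝ)) * D (T0 x init p.1) (T0 x init p.2)) ⟨(i, i'), by simpa using hne⟩
  simp only [Finset.mem_filter, Finset.mem_univ, true_and, Prod.forall] at hi hmin
  set a := 1 / (2 * (n : ℝ)) * D (T0 x init i₁) (T0 x init i₂) with ha
  have ha0 : 0 ≤ a := mul_nonneg (by positivity) (D_nonneg _ _)
  have ha1 : a ≤ 1 / 4 := by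
    calc a ≤ 1 / (2 * (n : ℝ)) * (n * R / 2) := (hmin i i' hne).trans (by gcongr)
      _ = R / 4 := by field_simp; ring
      _ ≤ 1 / 4 := by linarith
  have hs := Real.sq_sqrt (show 0 ≤ 1 - 4 * a by linarith)
  have hs1 : √(1 - 4 * a) ≤ 1 := Real.sqrt_le_one.2 (by linarith)
  refine ⟨(1 - √(1 - 4 * a)) / 2, by linarith, by linarith [Real.sqrt_nonneg (1 - 4 * a)], ?_⟩
  have : (1 - √(1 - 4 * a)) / 2 * (1 - (1 - √(1 - 4 * a)) / 2) = a := by nlinarith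
  rw [this]
  refine ⟨⟨i₁, i₂, hi, rfl⟩, ?_⟩
  rintro b ⟨j, j', hj, rfl⟩
  exact hmin j j' hj

end NoiseEstimate

/-! ### Deterministic analysis of both rounds -/

/-- On a sample whose distances are concentrated, the two-round EM algorithm succeeds. -/
theorem succeeds_of_concentrated {k n m l : ℕ} {P : Fin k → Fin n → Bool} {z : Fin m → Fin k}
    {y : Fin m → Fin n → Bool} {init : Fin l → Fin m} {u v g R Δ κ err wmin : ℝ}
    (hn : 0 < n) (hm : 0 < m) (hk : 0 < k) (hR0 : 0 < R) (hR1 : R < 1) (hu : 0 ≤ u) (hv : v ≤ n)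
    (hg : g ≤ n) (hΔ : u + Δ ≤ v) (hwmin : 0 < wmin) (herr0 : 0 < err)
    (hκ : κ = 4 * l * R ^ Δ) (hκ1 : κ ≤ 1 / 10) (hgap : u + 6 * κ * n < g)
    (hΔ2 : 0 < Δ - 2 * κ * n)
    (herr : R ^ (Δ - 2 * κ * n) * (2 / wmin * n + k * (n + err)) ≤ err)
    (hsame : ∀ j j', z j = z j' → D (vec (y j)) (vec (y j')) ≤ u)
    (hdiff : ∀ j j', z j ≠ z j' → v ≤ D (vec (y j)) (vec (y j')))
    (hsigned : ∀ j j', z j ≠ z j' →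
      g ≤ signedGap (vec (P (z j))) (vec (P (z j'))) (vec (y j)) (vec (y j')))
    (hhit : ∀ a, ∃ i, z (init i) = a)
    (hbal : ∀ a, (m : ℝ) * (Finset.univ.filter fun i => z (init i) = a).card ≤
      3.8 * l * (Finset.univ.filter fun j => z j = a).card)
    (hcard : ∀ a, m * wmin ≤ 2 * (Finset.univ.filter fun j => z j = a).card)
    (hpair : ∃ i i', i ≠ i' ∧ D (vec (y (init i))) (vec (y (init i'))) ≤ n * R / 2) :
    Succeeds P err z y init := by
  classical
  have hn' : (0 : ℝ) < n := by exact_mod_cast hn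
  have hm' : (0 : ℝ) < m := by exact_mod_cast hm
  have hk' : (0 : ℝ) < k := by exact_mod_cast hk
  obtain ⟨i₀, -⟩ := hhit ⟨0, hk⟩
  have hl : 0 < l := i₀.pos
  have hl' : (0 : ℝ) < l := by exact_mod_cast hl
  have : Nonempty (Fin l) := ⟨i₀⟩
  have : Nonempty (Fin k) := ⟨⟨0, hk⟩⟩
  set x : Fin m → Fin n → ℝ := fun j => vec (y j) with hx
  have hη0 : 0 < R ^ Δ := Real.rpow_pos_of_pos hR0 _
  have hκ0 : 0 < κ := by rw [hκ]; positivity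
  have hΔ0 : 0 < Δ := by have : 0 < 2 * κ * n := by positivity
                         linarith
  have hScard : ∀ a, 0 < (Finset.univ.filter fun j => z j = a).card := fun a => by
    have h1 := hcard a
    have h2 : 0 < m * wmin := mul_pos hm' hwmin
    have h3 : (0 : ℝ) < (Finset.univ.filter fun j => z j = a).card := by linarith
    exact_mod_cast h3
  -- first round
  have hw1 : ∀ _i : Fin l, (0 : ℝ) < 1 / (l : ℝ) := fun _ => by positivity
  have round1 : ∀ q₀, IsNoiseEstimate x init q₀ → ∀ j i, z j ≠ z (init i) →
      posterior (fun _ => 1 / (l : ℝ)) q₀ (T0 x init) (x j) i ≤ R ^ Δ := by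
    intro q₀ hq₀ j i hji
    obtain ⟨i', hi'⟩ := hhit (z j)
    refine posterior_le_rpow (hw1 i) hq₀.1 hq₀.2.1 hR0 (hq₀.le hn hpair) hΔ0 _ _ i i' ?_
    have h1 := hsame j (init i') hi'.symm
    have h2 := hdiff j (init i) hji
    simp only [T0, hx]
    linarith
  have hmix : ∀ q₀, IsNoiseEstimate x init q₀ → ∀ i, Survives x init q₀ i →
      IsClusterMixture z y (z (init i)) κ (T1 x init q₀ i) := by
    intro q₀ hq₀ i hi
    have := isClusterMixture_emTemplate (fun i => (hw1 i).le) hq₀.1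
      (hq₀.2.1.trans (by norm_num)) hm (z := z) (y := y) (a := z (init i)) (i := i)
      (T := T0 x init)
      (θ := 1 / (4 * (l : ℝ))) (by positivity) hη0.le hi (fun j hj => round1 q₀ hq₀ j i hj)
    have e : R ^ Δ / (1 / (4 * (l : ℝ))) = κ := by rw [hκ]; field_simp
    rw [e] at this
    exact this
  have hsurv : ∀ q₀, IsNoiseEstimate x init q₀ → ∀ a, ∃ i, Survives x init q₀ i ∧
      z (init i) = a := by
    intro q₀ hq₀ a
    by_contra hcon
    push Not at hcon
    -- If every template of class `a` fell below the threshold, their joint mass would be at most `m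
    -- * A.card / (4 l)`, which `hbal` bounds by `3.8 / 4 = 0.95` times the cluster size. The
    -- examples of the cluster alone contribute at least `1 - l R ^ Δ ≥ 0.975` times that size.
    set A := Finset.univ.filter fun i => z (init i) = a with hA
    have hlt : ∀ i ∈ A, w1 x init q₀ i ≤ 1 / (4 * (l : ℝ)) := fun i hi => by
      by_contra h
      exact hcon i (not_le.1 h).le (by simpa [hA] using hi)
    have h1 : ∑ i ∈ A, w1 x init q₀ i ≤ A.card * (1 / (4 * (l : ℝ))) := by
      simpa using Finset.sum_le_sum hlt
    have h2 : m * ∑ i ∈ A, w1 x init q₀ i =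
        ∑ j, ∑ i ∈ A, posterior (fun _ => 1 / (l : ℝ)) q₀ (T0 x init) (x j) i := by
      rw [Finset.mul_sum, Finset.sum_comm]
      exact Finset.sum_congr rfl fun i _ => emWeight_mul hm x i
    have h3 : ((Finset.univ.filter fun j => z j = a).card : ℝ) * (1 - l * R ^ Δ) ≤
        ∑ j, ∑ i ∈ A, posterior (fun _ => 1 / (l : ℝ)) q₀ (T0 x init) (x j) i := by
      refine card_filter_mul_le_sum z a _ (fun j => Finset.sum_nonneg fun i _ =>
        posterior_nonneg_of_nonneg (fun i => (hw1 i).le) hq₀.1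
          (hq₀.2.1.trans (by norm_num)) _ _ _) fun j hj => ?_
      have := one_sub_le_sum_posterior hw1 q₀ (T0 x init) (x j) A hη0.le fun i hi =>
        round1 q₀ hq₀ j i fun h => hi (by simp [hA, ← h, hj])
      simpa using this
    have h4 := hbal a
    have h5 : (0 : ℝ) < (Finset.univ.filter fun j => z j = a).card := by exact_mod_cast hScard a
    have h6 : l * R ^ Δ ≤ 1 / 40 := by linarith
    have h7 : m * ∑ i ∈ A, w1 x init q₀ i ≤ m * (A.card * (1 / (4 * (l : ℝ)))) := by gcongr
    have h8 : m * (A.card * (1 / (4 * (l : ℝ)))) ≤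
        3.8 * l * (Finset.univ.filter fun j => z j = a).card * (1 / (4 * (l : ℝ))) := by
      rw [← mul_assoc]; gcongr
    have h9 : 3.8 * l * (Finset.univ.filter fun j => z j = a).card * (1 / (4 * (l : ℝ))) =
        0.95 * (Finset.univ.filter fun j => z j = a).card := by field_simp; norm_num
    nlinarith
  -- second round
  refine ⟨?_, ?_⟩
  · obtain ⟨q₀, hq₀⟩ := exists_isNoiseEstimate hn hR1.le hpair (x := x) (init := init)
    choose f hf1 hf2 using hsurv q₀ hq₀
    obtain ⟨sel, h1, h2, h3⟩ := exists_farthest_first (Survives x init q₀)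
      (fun i i' => D (T1 x init q₀ i) (T1 x init q₀ i')) f
      (fun a b h => by rw [← hf2 a, ← hf2 b, h]) hf1
    exact ⟨q₀, sel, hq₀, h1, h2, h3⟩
  · rintro q₀ sel ⟨hq₀, -, hS, hsel⟩
    have hinj := farthest_first_injective (Survives x init q₀)
      (fun i i' => D (T1 x init q₀ i) (T1 x init q₀ i')) (fun i => z (init i))
      (α := u + 2 * κ * n) (β := g - 4 * κ * n) (by linarith)
      (fun i i' hi hi' h => (hmix q₀ hq₀ i hi).D_le hu hsame (by
        rw [show z (init i) = z (init i') from h]; exact hmix q₀ hq₀ i' hi'))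
      (fun i i' hi hi' h => (hmix q₀ hq₀ i hi).le_D hg h hsigned (hmix q₀ hq₀ i' hi'))
      (hsurv q₀ hq₀) sel hS hsel
    set σ : Equiv.Perm (Fin k) :=
      Equiv.ofBijective _ (Finite.injective_iff_bijective.1 hinj) with hσ
    have hσ' : ∀ r, σ r = z (init (sel r)) := fun r => rfl
    have hw2 : ∀ _i : Fin k, (0 : ℝ) < 1 / (k : ℝ) := fun _ => by positivity
    set η := R ^ (Δ - 2 * κ * n) with hη
    have hη0 : 0 < η := Real.rpow_pos_of_pos hR0 _
    have round2 : ∀ j r, z j ≠ σ r →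
        posterior (fun _ => 1 / (k : ℝ)) q₀ (fun r => T1 x init q₀ (sel r)) (x j) r ≤ η := by
      intro j r hjr
      refine posterior_le_rpow (hw2 r) hq₀.1 hq₀.2.1 hR0 (hq₀.le hn hpair) hΔ2 _ _ r
        (σ.symm (z j)) ?_
      -- Contamination moves each of the two distances by at most `κ n`, so a difference `Δ - 2 κ n`
      -- remains.
      have h1 := (hmix q₀ hq₀ _ (hS (σ.symm (z j)))).D_example_le hu hsame (j := j)
        (by rw [← hσ']; simp)
      have h2 := (hmix q₀ hq₀ _ (hS r)).le_D_example hv hdiff (j := j) hjr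
      simp only [hx]
      linarith
    have round2' : ∀ j r, z j = σ r → 1 - k * η ≤
        posterior (fun _ => 1 / (k : ℝ)) q₀ (fun r => T1 x init q₀ (sel r)) (x j) r := by
      intro j r hjr
      have := one_sub_le_sum_posterior hw2 q₀ (fun r => T1 x init q₀ (sel r)) (x j) {r} hη0.le
        fun i hi => round2 j i fun h => hi (by
          rw [Finset.mem_singleton]; exact σ.injective (h.symm.trans hjr))
      simpa using this
    refine ⟨σ.symm, fun a => ?_⟩
    -- By `herr`, `k η (n + err) < err`, which is below `n + err`.
    have hρ1 : k * η < 1 := by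
      have h1 : 0 < η * (2 / wmin * n) := by positivity
      have h2 : k * η * (n + err) < 1 * (n + err) := by nlinarith
      exact lt_of_mul_lt_mul_right h2 (by positivity)
    obtain ⟨h1, h2, h3⟩ := D_emTemplate_le hw2 hq₀.1 (hq₀.2.1.trans (by norm_num)) hm hη0.le hρ1
      (hScard a) (y := y) (i := σ.symm a) (T := fun r => T1 x init q₀ (sel r))
      (fun j hj => round2 j _ (by simpa using hj))
      (fun j hj => round2' j _ (by simpa using hj)) (P a)
    refine ⟨?_, h1, ?_⟩
    · rw [← hσ']; simp
    · have hmean0 := D_nonneg (clusterMean z x a) (vec (P a))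
      set S : ℝ := ((Finset.univ.filter fun j => z j = a).card : ℝ) with hSdef
      have hS0 : 0 < S := by simpa [hSdef] using hScard a
      have h4 : m / S ≤ 2 / wmin := by
        rw [div_le_div_iff₀ hS0 hwmin]; exact hcard a
      have h5 : m / S * η * n ≤ 2 / wmin * η * n := by gcongr
      -- Multiplied by `1 - k η`, the claim becomes `η (m / S * n + k (D + err)) ≤ err` with `D` the
      -- distance of the mean; it follows from `D ≤ n` and `herr`.
      refine le_of_mul_le_mul_left (a := 1 - k * η) ?_ (by linarith)
      refine h3.trans ?_
      have h6 : k * η * D (clusterMean z x a) (vec (P a)) ≤ k * η * n := by gcongr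
      change _ ≤ (1 - k * η) * (D (clusterMean z x a) (vec (P a)) + err)
      nlinarith

/-! ### Numerical bounds on the noise and choice of the thresholds -/

section Thresholds

variable {q c : ℝ}

lemma ratioBound_pos (hq : q ∈ Set.Ioo (0 : ℝ) (1 / 2)) : 0 < (1 - q) * (4 * q + √q) := by
  have := hq.1; have := hq.2
  have : 0 < 1 - q := by linarith
  positivity

lemma ratioBound_lt_one (hq : q ∈ Set.Ioo (0 : ℝ) (1 / 2)) (hB : 0 < B q) :
    (1 - q) * (4 * q + √q) < 1 := by
  have h0 := ratioBound_pos hq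
  have h1 : 0 < 1 / 2 * (1 - 2 * q) := by linarith [hq.2]
  have h2 := pos_of_mul_pos_right hB h1.le
  rw [Real.log_pos_iff (by positivity), lt_div_iff₀ h0] at h2
  linarith

lemma B_eq_log (q : ℝ) : -(2 * B q) = (1 - 2 * q) * Real.log ((1 - q) * (4 * q + √q)) := by
  rw [B, one_div ((1 - q) * (4 * q + √q)), Real.log_inv]; ring

/-- `B q > 0` means `4 q (1 - q) + (1 - q) √q < 1`. For `0.21 ≤ q < 1 / 2` the first term is at
least `0.66`, and the second at least `0.353` because `q (1 - q) ^ 2 ≥ 1 / 8` there. -/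
lemma noise_lt (hq : q ∈ Set.Ioo (0 : ℝ) (1 / 2)) (hB : 0 < B q) : q < 0.21 := by
  by_contra h
  push Not at h
  have h1 := ratioBound_lt_one hq hB
  have hq2 := hq.2
  have h2 := Real.sqrt_nonneg q
  have h3 := Real.sq_sqrt hq.1.le
  have h4 : (0.353 : ℝ) ≤ (1 - q) * √q := by
    refine abs_le_of_sq_le_sq' ?_ (mul_nonneg (by linarith) h2) |>.2
    rw [mul_pow, h3]
    nlinarith [mul_nonneg (show 0 ≤ 1 / 2 - q by linarith)
      (show 0 ≤ -(q ^ 2 - 1.5 * q + 1 / 4) by nlinarith)]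
  nlinarith

/-- This supplies the factor `q` in the error `ε q`: two spare powers of `R` are traded for `6 q`.
-/
lemma ratioBound_sq_le (hq : q ∈ Set.Ioo (0 : ℝ) (1 / 2)) (hB : 0 < B q) :
    ((1 - q) * (4 * q + √q)) ^ 2 ≤ 6 * q := by
  have h0 := noise_lt hq hB
  have h1 := hq.1
  set s := √q with hs
  have hs0 : 0 ≤ s := Real.sqrt_nonneg q
  have h3 : s ^ 2 = q := Real.sq_sqrt hq.1.le
  have hs1 : s ≤ 0.46 := abs_le_of_sq_le_sq' (by rw [h3]; norm_num; linarith) (by norm_num) |>.2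
  have h4 : (1 - q) * (1 + 4 * s) ≤ 2.44 := by
    rw [← h3]
    nlinarith [mul_nonneg (sub_nonneg.2 hs1) (sq_nonneg s), mul_nonneg hs0 (sub_nonneg.2 hs1)]
  have h5 : 0 ≤ (1 - q) * (1 + 4 * s) := mul_nonneg (by linarith) (by linarith)
  have h6 : (1 - q) * (4 * q + s) = s * ((1 - q) * (1 + 4 * s)) := by rw [← h3]; ring
  rw [h6, mul_pow, h3, mul_comm]
  have : ((1 - q) * (1 + 4 * s)) ^ 2 ≤ 2.44 ^ 2 := by gcongr
  nlinarith

/-- Thresholds for the distances between the examples, per component: `p + L + A` for equal labels,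
`M (1 - γ)` for different labels, `c (1 - 2 q - τ)` for the signed distance. -/
structure Thresholds (q c e L A γ τ : ℝ) : Prop where
  L_def : L = min c 0.5 * e ^ 2 / 3
  L_pos : 0 < L
  A_nonneg : 0 ≤ A
  A_sq : A ^ 2 = 4 * (q * (1 - q)) * L
  γ_nonneg : 0 ≤ γ
  γ_le_one : γ ≤ 1
  L_le : L ≤ γ ^ 2 * (c * (1 - 2 * q) ^ 2 + 2 * (q * (1 - q))) / 2
  τ_pos : 0 < τ
  τ_le : 2 * q + τ ≤ 1
  L_mul_le : L * (4 * q + τ) ≤ c * τ ^ 2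
  gap : 2 * (q * (1 - q)) + L + A + 0.28 * (c * (1 - 2 * q)) ≤
    (c * (1 - 2 * q) ^ 2 + 2 * (q * (1 - q))) * (1 - γ)
  signed_gap : 2 * (q * (1 - q)) + L + A + 0.1 * c ≤ c * (1 - 2 * q - τ)

/-- All deviations are controlled linearly in `e`: `L ≤ c e / 12` and `A ≤ 0.82 e √q`. Then `he2`,
from the second term of `E`, yields `gap`, and `he3`, from the third, yields `signed_gap`. -/
lemma exists_thresholds (hq0 : 0 < q) (hq : q < 0.21) (hc0 : 0 < c) {e : ℝ} (he0 : 0 < e)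
    (he1 : e ≤ 1 / 4)
    (he2 : e * (c * (1 - 2 * q) ^ 2 + 2 * (1 - q) * (q + √q)) ≤ c * (1 - 2 * q) ^ 2 / 2)
    (he3 : e * (c * (1 - 2 * q) + q + √q) ≤ 3 * c * (1 - 2 * q) / 4 - 2 * q) :
    ∃ L A γ τ, Thresholds q c e L A γ τ := by
  set s := √q with hs
  have hs0 : 0 ≤ s := Real.sqrt_nonneg q
  have hs2 : s ^ 2 = q := Real.sq_sqrt hq0.le
  have hs1 : s ≤ 0.46 := abs_le_of_sq_le_sq' (by rw [hs2]; norm_num; linarith) (by norm_num) |>.2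
  set L := min c 0.5 * e ^ 2 / 3 with hL
  have hmin : 0 < min c 0.5 := lt_min hc0 (by norm_num)
  have hL0 : 0 < L := by positivity
  have he20 : 0 < e ^ 2 := by positivity
  have hL1 : L ≤ c * e ^ 2 / 3 := by
    have := mul_le_mul_of_nonneg_right (min_le_left c (0.5 : ℝ)) he20.le
    linarith
  have hL2 : L ≤ e ^ 2 / 6 := by
    have := mul_le_mul_of_nonneg_right (min_le_right c (0.5 : ℝ)) he20.le
    linarith
  have hee : e ^ 2 ≤ e / 4 := by nlinarith
  have hce : c * e ^ 2 ≤ c * e / 4 := by nlinarith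
  have hce' : c * e ≤ c / 4 := by nlinarith
  have hce0 : 0 < c * e := by positivity
  have hes : 0 ≤ e * s := by positivity
  have h1q : 0 < q * (1 - q) := mul_pos hq0 (by linarith)
  have hq1q : q * (1 - q) ≤ q := by nlinarith
  set A := √(4 * (q * (1 - q)) * L) with hA
  have hA2 : A ^ 2 = 4 * (q * (1 - q)) * L := Real.sq_sqrt (by positivity)
  have hA1 : A ≤ 0.82 * (e * s) := by
    refine abs_le_of_sq_le_sq' ?_ (by positivity) |>.2
    have h1 : 4 * (q * (1 - q)) * L ≤ 4 * q * (e ^ 2 / 6) := by gcongr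
    have h2 : 0 < q * e ^ 2 := by positivity
    rw [hA2, mul_pow, mul_pow, hs2]
    linarith only [h1, h2]
  set r := √(4 * q * (e ^ 2 / 3)) with hr
  have hr0 : 0 ≤ r := Real.sqrt_nonneg _
  have hr2 : r ^ 2 = 4 * q * (e ^ 2 / 3) := Real.sq_sqrt (by positivity)
  have hr1 : r ≤ 1.16 * (e * s) := by
    refine abs_le_of_sq_le_sq' ?_ (by positivity) |>.2
    have h2 : 0 < q * e ^ 2 := by positivity
    rw [hr2, mul_pow, mul_pow, hs2]
    linarith only [h2]
  have hes1 : e * s ≤ 0.46 * e := by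
    rw [mul_comm]; exact mul_le_mul_of_nonneg_right hs1 he0.le
  have hcr : c * r ≤ 0.5336 * (c * e) := by
    have := mul_le_mul_of_nonneg_left (show r ≤ 0.5336 * e by linarith) hc0.le
    linarith
  have hcq : 0.58 * c ≤ c * (1 - 2 * q) := by
    have := mul_le_mul_of_nonneg_left (show 0.58 ≤ 1 - 2 * q by linarith) hc0.le
    linarith
  have hecq : 0.58 * (c * e) ≤ e * (c * (1 - 2 * q)) := by
    have := mul_le_mul_of_nonneg_left hcq he0.le
    linarith
  -- `0.82 ^ 2 / 2` just exceeds `1 / 3`, the constant in `L`. The value of `τ` makes `τ ^ 2 ≥ (e ^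
  -- 2 / 3) (4 q + τ)`.
  refine ⟨L, A, 0.82 * e, e ^ 2 / 3 + r, rfl, hL0, Real.sqrt_nonneg _, hA2, by positivity,
    by linarith, ?_, by positivity, by linarith, ?_, ?_, ?_⟩
  -- The right side is a convex combination of `c` and `1 / 2`, as `(1 - 2 q) ^ 2 + 4 q (1 - q) =
  -- 1`.
  · have h1 : min c 0.5 ≤ c * (1 - 2 * q) ^ 2 + 2 * (q * (1 - q)) := by
      have h2 := min_le_left c (0.5 : ℝ)
      have h3 := min_le_right c (0.5 : ℝ)
      have h4 := mul_le_mul_of_nonneg_right h2 (sq_nonneg (1 - 2 * q))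
      have h5 := mul_le_mul_of_nonneg_right h3 h1q.le
      nlinarith
    have h2 := mul_le_mul_of_nonneg_right h1 he20.le
    have h3 : 0 < (c * (1 - 2 * q) ^ 2 + 2 * (q * (1 - q))) * e ^ 2 := by positivity
    rw [hL, mul_pow]
    linarith only [h2, h3]
  · have h1 : (e ^ 2 / 3) * (4 * q + (e ^ 2 / 3 + r)) ≤ (e ^ 2 / 3 + r) ^ 2 := by
      have : 0 ≤ e ^ 2 / 3 * r := by positivity
      nlinarith
    calc L * (4 * q + (e ^ 2 / 3 + r)) ≤ c * e ^ 2 / 3 * (4 * q + (e ^ 2 / 3 + r)) := by gcongr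
      _ = c * ((e ^ 2 / 3) * (4 * q + (e ^ 2 / 3 + r))) := by ring
      _ ≤ _ := by gcongr
  · have h1 : 0.82 * (e * s) ≤ 1.64 * ((1 - q) * (e * s)) := by nlinarith only [hes, hq]
    have h2 : 0.28 * (1 - 2 * q) + 1 / 48 ≤ 0.59 * (1 - 2 * q) ^ 2 := by nlinarith only [hq, hq0]
    have h3 := mul_le_mul_of_nonneg_left h2 hc0.le
    linarith only [he2, hA1, h1, h3, hL1, hce, hce']
  · have h1 : 0 < e * q := mul_pos he0 hq0
    linarith only [he3, hA1, h1, hL1, hce, hce', hcr, hcq, hecq, hq1q, hes, hc0]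

end Thresholds

lemma IsSeparated.le {k n : ℕ} {P : Fin k → Fin n → Bool} {c : ℝ} (hc : IsSeparated P c)
    (hn : 0 < n) {a b : Fin k} (hab : a ≠ b) : c * n ≤ D (vec (P a)) (vec (P b)) := by
  have hn' : (0 : ℝ) < n := by exact_mod_cast hn
  have := hc.2 ⟨a, b, hab, rfl⟩
  rwa [le_div_iff₀ hn'] at this

lemma IsSeparated.le_one {k n : ℕ} {P : Fin k → Fin n → Bool} {c : ℝ} (hc : IsSeparated P c) :
    c ≤ 1 := by
  obtain ⟨a, b, -, rfl⟩ := hc.1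
  exact div_le_one_of_le₀ (D_vec_le _ _) (Nat.cast_nonneg n)

lemma IsSeparated.two_le {k n : ℕ} {P : Fin k → Fin n → Bool} {c : ℝ} (hc : IsSeparated P c) :
    2 ≤ k := by
  obtain ⟨a, b, hab, -⟩ := hc.1
  by_contra h
  exact hab (by ext; omega)

/-! ### Consequences of the size hypotheses -/

section E

variable {q c : ℝ} {l n : ℕ}

/-- With `2` in place of the inner maximum, the hypothesis says exactly that the numerator of the
third term of `E` is positive. -/
lemma E_bounds (hq0 : 0 < q) (hq : q < 1 / 2) (hc0 : 0 < c)
    (h : max (3 * (1 - 2 * q)) 2 / (3 * (1 - 2 * q)) * (4 * q + 8 * √(6 * q * l / n)) < c) :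
    0 < E q c l n ∧ E q c l n ≤ 1 / 4 ∧
      E q c l n * (c * (1 - 2 * q) ^ 2 + 2 * (1 - q) * (q + √q)) ≤ c * (1 - 2 * q) ^ 2 / 2 ∧
      E q c l n * (c * (1 - 2 * q) + q + √q) ≤ 3 * c * (1 - 2 * q) / 4 - 2 * q := by
  have h2q : 0 < 1 - 2 * q := by linarith
  have h1q : 0 < 1 - q := by linarith
  have hr : 0 ≤ √(6 * q * l / n) := Real.sqrt_nonneg _
  have hs : 0 ≤ √q := Real.sqrt_nonneg _
  have h2 : 2 / (3 * (1 - 2 * q)) * (4 * q + 8 * √(6 * q * l / n)) < c :=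
    lt_of_le_of_lt (by gcongr; exact le_max_right _ _) h
  rw [div_mul_eq_mul_div, div_lt_iff₀ (by positivity)] at h2
  have hd2 : 0 < c * (1 - 2 * q) ^ 2 + 2 * (1 - q) * (q + √q) := by positivity
  have hd3 : 0 < c * (1 - 2 * q) + q + √q := by positivity
  refine ⟨?_, min_le_left _ _, ?_, ?_⟩
  · refine lt_min (by norm_num) (lt_min (by positivity) (div_pos (by linarith) hd3))
  · rw [← le_div_iff₀ hd2]
    exact (min_le_right _ _).trans (min_le_left _ _)
  · have : E q c l n * (c * (1 - 2 * q) + q + √q) ≤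
        3 * c * (1 - 2 * q) / 4 - 2 * q - 4 * √(6 * q * l / n) := by
      rw [← le_div_iff₀ hd3]
      exact (min_le_right _ _).trans (min_le_right _ _)
    linarith

end E

/-- The number of initial templates is at most polynomial. -/
lemma numInit_le {l n k : ℕ} {wmin δ : ℝ} (hk : 2 ≤ k) (hwmin : 0 < wmin) (hkw : k * wmin ≤ 1)
    (hδ : δ ∈ Set.Ioo (0 : ℝ) 1) (hl : l = ⌈4 / wmin * Real.log (2 / (δ * wmin))⌉₊)
    (hn : 6 * k / δ < n) : (l : ℝ) ≤ n / wmin ^ 2 := by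
  have hk' : (2 : ℝ) ≤ k := by exact_mod_cast hk
  have hw1 : wmin ≤ 1 / 2 := by nlinarith
  have h0 := hδ.1
  have h1 : 0 < δ * wmin := mul_pos h0 hwmin
  have h2 : 1 ≤ 2 / (δ * wmin) := by
    rw [le_div_iff₀ h1]; nlinarith [hδ.2]
  have h3 : (l : ℝ) < 4 / wmin * Real.log (2 / (δ * wmin)) + 1 := by
    rw [hl]; exact Nat.ceil_lt_add_one (mul_nonneg (by positivity) (Real.log_nonneg h2))
  have h4 : Real.log (2 / (δ * wmin)) ≤ 2 / (δ * wmin) - 1 :=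
    Real.log_le_sub_one_of_pos (by positivity)
  have h5 : 12 < n * δ := by rw [div_lt_iff₀ h0] at hn; linarith
  have h6 : 2 / (δ * wmin) ≤ n / (6 * wmin) := by
    rw [div_le_div_iff₀ h1 (by positivity)]; nlinarith
  have h7 : 4 / wmin * Real.log (2 / (δ * wmin)) ≤ 4 / wmin * (n / (6 * wmin) - 1) := by
    gcongr; linarith
  have h8 : 4 / wmin * (n / (6 * wmin) - 1) + 1 ≤ n / wmin ^ 2 := by
    have : n / wmin ^ 2 - (4 / wmin * (n / (6 * wmin) - 1) + 1) =
        (n / 3 + wmin * (4 - wmin)) / wmin ^ 2 := by field_simp; ring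
    have : 0 ≤ (n / 3 + wmin * (4 - wmin)) / wmin ^ 2 :=
      div_nonneg (add_nonneg (by positivity) (mul_nonneg hwmin.le (by linarith)))
        (by positivity)
    linarith
  linarith

/-- Smallness of the contamination in both rounds. -/
lemma contamination_bounds {R b ε wmin q lr : ℝ} {n k : ℕ} (hR0 : 0 < R) (hR1 : R < 1)
    (hRq : R ^ 2 ≤ 6 * q) (hε : ε ∈ Set.Ioo (0 : ℝ) 1) (hwmin : 0 < wmin) (hk : 2 ≤ k)
    (hkw : k * wmin ≤ 1) (hq : q ∈ Set.Ioo (0 : ℝ) (1 / 2)) (hn : 100 ≤ n)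
    (hb : 160 ≤ b) (hR : R ^ (b / 8) ≤ ε * wmin / (5 * n))
    (hl : lr ≤ n / wmin ^ 2) :
    4 * lr * R ^ (0.28 * b) * n ≤ 0.16 ∧
      R ^ (0.28 * b - 2 * (4 * lr * R ^ (0.28 * b)) * n) *
        (2 / wmin * n + k * (n + ε * q)) ≤ ε * q := by
  have hn' : (100 : ℝ) ≤ n := by exact_mod_cast hn
  have hn0 : (0 : ℝ) < n := by linarith
  have hε0 := hε.1
  have hq0 := hq.1
  have hk' : (2 : ℝ) ≤ k := by exact_mod_cast hk
  have hw1 : wmin ≤ 1 / 2 := by nlinarith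
  have hsq : R ^ (b / 4) ≤ (ε * wmin / (5 * n)) ^ 2 := by
    calc R ^ (b / 4) = (R ^ (b / 8)) ^ 2 := by
          rw [← Real.rpow_natCast, ← Real.rpow_mul hR0.le]; congr 1; push_cast; ring
      _ ≤ _ := by gcongr
  have hεw : ε * wmin / (5 * n) ≤ wmin / (5 * n) := by
    gcongr; exact mul_le_of_le_one_left hwmin.le hε.2.le
  have hsq' : R ^ (b / 4) ≤ (wmin / (5 * n)) ^ 2 := hsq.trans (by gcongr)
  have h28 : R ^ (0.28 * b) ≤ (wmin / (5 * n)) ^ 2 :=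
    (Real.rpow_le_rpow_of_exponent_ge hR0 hR1.le (by linarith)).trans hsq'
  have h1 : 4 * lr * R ^ (0.28 * b) * n ≤ 0.16 := by
    calc 4 * lr * R ^ (0.28 * b) * n ≤ 4 * (n / wmin ^ 2) * (wmin / (5 * n)) ^ 2 * n := by gcongr
      _ = 0.16 := by field_simp; norm_num
  refine ⟨h1, ?_⟩
  -- The contamination lowers the exponent by at most `0.32`, while `0.03 b ≥ 4.8`; so the exponent
  -- is still at least `2 + b / 4`.
  have h2 : R ^ (0.28 * b - 2 * (4 * lr * R ^ (0.28 * b)) * n) ≤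
      6 * q * (ε * wmin / (5 * n)) ^ 2 := by
    calc _ ≤ R ^ (2 + b / 4) := Real.rpow_le_rpow_of_exponent_ge hR0 hR1.le (by linarith)
      _ = R ^ 2 * R ^ (b / 4) := by
          rw [Real.rpow_add hR0]; norm_num
      _ ≤ _ := by gcongr
  have hεq : ε * q ≤ 1 := by nlinarith [hε.2, hq.2]
  have h3 : 2 / wmin * n + k * (n + ε * q) ≤ 4 * n / wmin := by
    have : (k : ℝ) ≤ 1 / wmin := by rw [le_div_iff₀ hwmin]; exact hkw
    calc 2 / wmin * n + k * (n + ε * q) ≤ 2 / wmin * n + 1 / wmin * (n + 1) := by gcongr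
      _ = (3 * n + 1) / wmin := by field_simp; ring
      _ ≤ _ := by gcongr; linarith
  calc _ ≤ 6 * q * (ε * wmin / (5 * n)) ^ 2 * (4 * n / wmin) := by gcongr
    _ = ε * q * (24 / 25 * (ε * (wmin / n))) := by field_simp; ring
    _ ≤ ε * q * 1 := by
        have : wmin / n ≤ 1 := by rw [div_le_one hn0]; linarith
        have h4 : ε * (wmin / n) ≤ 1 := mul_le_one₀ hε.2.le (by positivity) this
        gcongr
        linarith
    _ = ε * q := mul_one _

/-- `B` is the decay rate: `R ^ (1 - 2 q) = exp (-2 B)`, so the left side is `exp (-c n B / 4)`. -/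
lemma ratioBound_rpow_le {q c ε wmin : ℝ} {n : ℕ} (hq : q ∈ Set.Ioo (0 : ℝ) (1 / 2))
    (hB : 0 < B q) (hn : 0 < n) (hε : 0 < ε) (hwmin : 0 < wmin)
    (h : 4 / (n * B q) * Real.log (5 * n / (ε * wmin)) < c) :
    ((1 - q) * (4 * q + √q)) ^ (c * (1 - 2 * q) * n / 8) ≤ ε * wmin / (5 * n) := by
  have hR0 := ratioBound_pos hq
  have hn' : (0 : ℝ) < n := by exact_mod_cast hn
  rw [Real.rpow_def_of_pos hR0, ← Real.le_log_iff_exp_le (by positivity)]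
  have e1 : Real.log ((1 - q) * (4 * q + √q)) * (c * (1 - 2 * q) * n / 8) =
      -(c * n * B q / 4) := by
    have := B_eq_log q
    linear_combination (-(c * n / 8)) * this
  have e2 : Real.log (ε * wmin / (5 * n)) = -Real.log (5 * n / (ε * wmin)) := by
    rw [← Real.log_inv, inv_div]
  rw [e1, e2]
  rw [div_mul_eq_mul_div, div_lt_iff₀ (by positivity)] at h
  linarith

lemma exp_neg_le {δ s X : ℝ} (hδ : 0 < δ) (hX : 0 < X) (h : Real.log (X / δ) ≤ s) :
    Real.exp (-s) ≤ δ / X := by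
  calc Real.exp (-s) ≤ Real.exp (-Real.log (X / δ)) := Real.exp_le_exp.2 (by linarith)
    _ = δ / X := by rw [← Real.log_inv, inv_div, Real.exp_log (by positivity)]

/-- The number of components that tell two templates apart is large. -/
lemma separation_large {c e δ : ℝ} {m n : ℕ} (hc : 0 < c) (he0 : 0 < e) (he : e ≤ 1 / 4)
    (hδ : δ ∈ Set.Ioo (0 : ℝ) 1) (hm : 8 ≤ m)
    (h : 3 / (min c 0.5 * e ^ 2) * Real.log (12 * (m + 1) ^ 2 / δ) < n) :
    Real.exp (-(n * (min c 0.5 * e ^ 2 / 3))) ≤ δ / (12 * (m + 1) ^ 2) ∧ 288 ≤ n * c ∧ 576 ≤ n := by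
  have hmin : 0 < min c 0.5 := lt_min hc (by norm_num)
  have hδ0 := hδ.1
  have h1 : Real.log (12 * (m + 1) ^ 2 / δ) ≤ n * (min c 0.5 * e ^ 2 / 3) := by
    rw [div_mul_eq_mul_div, div_lt_iff₀ (by positivity)] at h
    linarith
  -- `m ≥ 8` gives `12 * 81 > exp 6`. With `e ^ 2 ≤ 1 / 16`, the size of `n` becomes `n * min c 0.5
  -- ≥ 3 * 6 * 16 = 288`.
  have h2 : 6 ≤ Real.log (12 * (m + 1) ^ 2 / δ) := by
    rw [Real.le_log_iff_exp_le (by positivity), le_div_iff₀ hδ0]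
    have h3 : Real.exp 6 ≤ 2.72 ^ 6 := by
      have : Real.exp 6 = Real.exp 1 ^ 6 := by rw [← Real.exp_nat_mul]; norm_num
      rw [this]
      exact pow_le_pow_left₀ (Real.exp_pos 1).le (Real.exp_one_lt_d9.le.trans (by norm_num)) 6
    have h4 : Real.exp 6 * δ ≤ Real.exp 6 := mul_le_of_le_one_right (Real.exp_pos _).le hδ.2.le
    have h5 : (8 : ℝ) ≤ m := by exact_mod_cast hm
    have h6 : (9 : ℝ) ^ 2 ≤ (m + 1) ^ 2 := by gcongr; linarith
    norm_num at h3 h6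
    linarith
  have h3 : e ^ 2 ≤ 1 / 16 := by nlinarith
  have h4 : 288 ≤ n * min c 0.5 := by
    have : n * min c 0.5 * e ^ 2 ≤ n * min c 0.5 * (1 / 16) := by gcongr
    linarith
  refine ⟨exp_neg_le hδ0 (by positivity) h1, ?_, ?_⟩
  · exact h4.trans (by gcongr; exact min_le_left _ _)
  · have : 288 ≤ n * (0.5 : ℝ) := h4.trans (by gcongr; exact min_le_right _ _)
    have h5 : (576 : ℝ) ≤ n := by linarith
    exact_mod_cast h5

/-! ### Chernoff and Chebyshev bounds -/

section Tail

variable {Ω : Type*} [MeasurableSpace Ω] {μ : Measure Ω} [IsProbabilityMeasure μ]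

/-- `1 + r (exp t - 1) ≤ exp (r (exp t - 1))`: an indicator is dominated by a Poisson variable of
the same mean. This form adds up over independent terms with unequal probabilities. -/
lemma mgf_ite_le {A : Set Ω} (hA : MeasurableSet A) (t : ℝ) :
    mgf (A.indicator 1) μ t ≤ Real.exp (μ.real A * (Real.exp t - 1)) := by
  have h : ∀ ω, Real.exp (t * (A.indicator 1 : Ω → ℝ) ω) =
      1 + A.indicator (fun _ => Real.exp t - 1) ω := by
    intro ω
    by_cases hω : ω ∈ A <;> simp [hω]
  unfold mgf
  simp only [h]
  rw [integral_add (integrable_const _) ((integrable_const _).indicator hA),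
    integral_indicator_const _ hA]
  simp only [integral_const, probReal_univ, smul_eq_mul, mul_one]
  linarith [Real.add_one_le_exp (μ.real A * (Real.exp t - 1))]

variable [Finite Ω] [MeasurableSingletonClass Ω] {ι : Type*} [Fintype ι] {X : ι → Ω → ℝ}
  {p : ι → ℝ}

omit [IsProbabilityMeasure μ] [Finite Ω] [MeasurableSingletonClass Ω] in
lemma mgf_sum_le (hX : iIndepFun X μ) (hm : ∀ i, Measurable (X i))
    (hmgf : ∀ i t, mgf (X i) μ t ≤ Real.exp (p i * (Real.exp t - 1))) (t : ℝ) :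
    mgf (∑ i, X i) μ t ≤ Real.exp ((∑ i, p i) * (Real.exp t - 1)) := by
  rw [hX.mgf_sum hm, Finset.sum_mul, Real.exp_sum]
  exact Finset.prod_le_prod (fun i _ => mgf_nonneg) fun i _ => hmgf i t

/-- Chernoff bound for the upper tail of a sum whose moment generating function is dominated by
that of a Poisson variable. -/
lemma measure_sum_ge_le (hX : iIndepFun X μ) (hm : ∀ i, Measurable (X i))
    (hmgf : ∀ i t, mgf (X i) μ t ≤ Real.exp (p i * (Real.exp t - 1))) {M : ℝ} (hM : ∑ i, p i = M)
    (hM0 : 0 < M) {τ : ℝ} (hτ : 0 ≤ τ) :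
    μ.real {ω | M + τ ≤ ∑ i, X i ω} ≤ Real.exp (-(τ ^ 2 / (2 * M + τ))) := by
  set u := τ / M with hu
  have hu0 : 0 ≤ u := by positivity
  have hτu : τ = M * u := by rw [hu]; field_simp
  -- `t = log (1 + u)` is optimal for the Poisson bound; the stated exponent then comes from `log (1
  -- + u) ≥ 2 u / (u + 2)`.
  have h1 := measure_ge_le_exp_mul_mgf (μ := μ) (X := ∑ i, X i) (t := Real.log (1 + u)) (M + τ)
    (Real.log_nonneg (by linarith)) (Integrable.of_finite)
  simp only [Finset.sum_apply] at h1
  refine h1.trans ((mul_le_mul_of_nonneg_left (mgf_sum_le hX hm hmgf _)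
    (Real.exp_pos _).le).trans ?_)
  rw [← Real.exp_add, Real.exp_le_exp, Real.exp_log (by linarith), hM]
  have h2 := Real.le_log_one_add_of_nonneg hu0
  have h3 : (1 + u) * (2 * u / (u + 2)) ≤ (1 + u) * Real.log (1 + u) := by gcongr
  have h4 : τ ^ 2 / (2 * M + τ) = M * ((1 + u) * (2 * u / (u + 2)) - u) := by
    rw [hτu]; field_simp; ring
  rw [h4, hτu]
  nlinarith

/-- `(1 - s + s²/2) (1 + s + s²/2) = 1 + s⁴/4 ≥ 1`, and the second factor is at most `exp s`. -/
lemma exp_neg_le_quadratic {s : ℝ} (hs : 0 ≤ s) : Real.exp (-s) ≤ 1 - s + s ^ 2 / 2 := by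
  have h1 := Real.quadratic_le_exp_of_nonneg hs
  have h2 : 0 < 1 - s + s ^ 2 / 2 := by nlinarith [sq_nonneg (s - 1)]
  rw [Real.exp_neg, inv_le_iff_one_le_mul₀ (Real.exp_pos _)]
  have h3 : 1 ≤ (1 - s + s ^ 2 / 2) * (1 + s + s ^ 2 / 2) := by nlinarith [sq_nonneg (s ^ 2)]
  exact h3.trans (by gcongr)

/-- Chernoff bound for the lower tail of a sum whose moment generating function is dominated by
that of a Poisson variable. -/
lemma measure_sum_le_le (hX : iIndepFun X μ) (hm : ∀ i, Measurable (X i))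
    (hmgf : ∀ i t, mgf (X i) μ t ≤ Real.exp (p i * (Real.exp t - 1))) {M : ℝ} (hM : ∑ i, p i = M)
    (hM0 : 0 < M) {γ : ℝ} (hγ : 0 ≤ γ) :
    μ.real {ω | ∑ i, X i ω ≤ M * (1 - γ)} ≤ Real.exp (-(γ ^ 2 * M / 2)) := by
  -- `t = -γ` is not optimal, but with the quadratic bound for `exp (-γ)` it already gives `γ ^ 2 M
  -- / 2`.
  have h1 := measure_le_le_exp_mul_mgf (μ := μ) (X := ∑ i, X i) (t := -γ) (M * (1 - γ))
    (by linarith) (Integrable.of_finite)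
  simp only [Finset.sum_apply] at h1
  refine h1.trans ((mul_le_mul_of_nonneg_left (mgf_sum_le hX hm hmgf _)
    (Real.exp_pos _).le).trans ?_)
  rw [← Real.exp_add, Real.exp_le_exp, hM]
  have h2 := exp_neg_le_quadratic hγ
  nlinarith

lemma memLp_of_finite (f : Ω → ℝ) : MemLp f 2 μ :=
  (memLp_top_of_bound (C := ⨆ ω, ‖f ω‖) (Measurable.of_discrete).aestronglyMeasurable
    (ae_of_all _ fun ω => le_ciSup (f := fun ω => ‖f ω‖) (Set.finite_range _).bddAbove ω)).mono_exponent le_top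

/-- Chebyshev bound for the number of successes in independent trials. -/
lemma measure_count_ge_le {A : ι → Set Ω} (hX : iIndepFun (fun i => (A i).indicator (1 : Ω → ℝ)) μ)
    {r : ℝ} (hA : ∀ i, μ.real (A i) = r) {τ : ℝ} (hτ : 0 < τ) :
    μ.real {ω | Fintype.card ι * r + τ ≤ ∑ i, (A i).indicator (1 : Ω → ℝ) ω} ≤
      Fintype.card ι * r / τ ^ 2 := by
  set Y : ι → Ω → ℝ := fun i => (A i).indicator 1 with hY
  have hint : ∀ i, μ[Y i] = r := fun i => by
    rw [hY, integral_indicator_one (Set.toFinite _).measurableSet, hA]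
  have hmean : μ[∑ i, Y i] = Fintype.card ι * r := by
    simp only [Finset.sum_apply]
    rw [integral_finsetSum _ fun i _ => Integrable.of_finite]
    simp [hint]
  have hvar : variance (∑ i, Y i) μ ≤ Fintype.card ι * r := by
    rw [IndepFun.variance_sum (fun i _ => memLp_of_finite _)
      fun i _ j _ hij => hX.indepFun hij]
    calc ∑ i, variance (Y i) μ ≤ ∑ _i : ι, r := by
          refine Finset.sum_le_sum fun i _ => ?_
          refine (variance_le_expectation_sq
            (Measurable.of_discrete.aestronglyMeasurable)).trans ?_
          rw [← hint i]
          refine le_of_eq (integral_congr_ae (ae_of_all _ fun ω => ?_))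
          by_cases hω : ω ∈ A i <;> simp [hY, hω]
      _ = _ := by simp
  have h := meas_ge_le_variance_div_sq (memLp_of_finite (μ := μ) (∑ i, Y i)) hτ
  rw [hmean] at h
  have h2 : μ.real {ω | τ ≤ |(∑ i, Y i) ω - Fintype.card ι * r|} ≤
      variance (∑ i, Y i) μ / τ ^ 2 :=
    ENNReal.toReal_le_of_le_ofReal (div_nonneg (variance_nonneg _ _) (sq_nonneg _)) h
  refine (measureReal_mono fun ω hω => ?_).trans (h2.trans (by gcongr))
  simp only [Set.mem_ofPred_eq, Finset.sum_apply] at hω ⊢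
  exact le_trans (by linarith) (le_abs_self _)

end Tail

/-! ### The array of independent noise bits -/

/-- The law of one noise bit. -/
noncomputable def bitLaw (q : ℝ) : Measure Bool :=
  ENNReal.ofReal q • Measure.dirac true + ENNReal.ofReal (1 - q) • Measure.dirac false

lemma bitLaw_singleton (q : ℝ) (b : Bool) :
    bitLaw q {b} = ENNReal.ofReal (if b then q else 1 - q) := by
  cases b <;> simp [bitLaw]

lemma isProbabilityMeasure_bitLaw {q : ℝ} (hq : q ∈ Set.Icc (0 : ℝ) 1) :
    IsProbabilityMeasure (bitLaw q) := by
  constructor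
  simp only [bitLaw, Measure.add_apply, Measure.smul_apply, measure_univ, smul_eq_mul, mul_one]
  rw [← ENNReal.ofReal_add hq.1 (by linarith [hq.2])]
  simp

/-- The law of the noise: independent bits, one for each example and component. -/
noncomputable def noiseLaw (q : ℝ) (m n : ℕ) : Measure (Fin m → Fin n → Bool) :=
  Measure.pi fun _ => Measure.pi fun _ => bitLaw q

section Noise

variable {q : ℝ} {m n : ℕ}

lemma isProbabilityMeasure_noiseLaw (hq : q ∈ Set.Icc (0 : ℝ) 1) (m n : ℕ) :
    IsProbabilityMeasure (noiseLaw q m n) := by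
  have := isProbabilityMeasure_bitLaw hq
  unfold noiseLaw
  infer_instance

lemma noiseLaw_singleton (hq : q ∈ Set.Icc (0 : ℝ) 1) (ν : Fin m → Fin n → Bool) :
    noiseLaw q m n {ν} = ∏ j, ∏ s, ENNReal.ofReal (if ν j s then q else 1 - q) := by
  have := isProbabilityMeasure_bitLaw hq
  unfold noiseLaw
  simp only [Measure.pi_singleton, bitLaw_singleton]

lemma noiseLaw_map_swap (hq : q ∈ Set.Icc (0 : ℝ) 1) :
    (noiseLaw q m n).map (fun ν s j => ν j s) = noiseLaw q n m := by
  refine Measure.ext_of_singleton fun ν => ?_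
  rw [Measure.map_apply Measurable.of_discrete (measurableSet_singleton _)]
  have : (fun (ν : Fin m → Fin n → Bool) s j => ν j s) ⁻¹' {ν} = {fun j s => ν s j} := by
    ext ν'
    simp only [Set.mem_preimage, Set.mem_singleton_iff, funext_iff]
    exact ⟨fun h j s => h s j, fun h s j => h j s⟩
  rw [this, noiseLaw_singleton hq, noiseLaw_singleton hq, Finset.prod_comm]

lemma iIndepFun_rows (hq : q ∈ Set.Icc (0 : ℝ) 1) :
    iIndepFun (fun (j : Fin m) (ν : Fin m → Fin n → Bool) => ν j) (noiseLaw q m n) := by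
  have := isProbabilityMeasure_bitLaw hq
  exact iIndepFun_pi (X := fun _ => id) fun _ => aemeasurable_id

/-- Rows are independent by construction; columns are the rows of the transposed array, whose law is
again a noise law. -/
lemma iIndepFun_columns (hq : q ∈ Set.Icc (0 : ℝ) 1) :
    iIndepFun (fun (s : Fin n) (ν : Fin m → Fin n → Bool) j => ν j s) (noiseLaw q m n) := by
  have := isProbabilityMeasure_noiseLaw hq m n
  have h := iIndepFun_rows (m := n) (n := m) hq
  rw [← noiseLaw_map_swap hq] at h
  rw [iIndepFun_iff_map_fun_eq_pi_map fun _ => Measurable.of_discrete.aemeasurable]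
  have := Measure.isProbabilityMeasure_map (μ := noiseLaw q m n)
    (f := fun ν (s : Fin n) (j : Fin m) => ν j s) Measurable.of_discrete.aemeasurable
  have h2 := h.map_fun_eq_pi_map fun _ => Measurable.of_discrete.aemeasurable
  rw [Measure.map_map Measurable.of_discrete Measurable.of_discrete] at h2
  simp only [Measure.map_map Measurable.of_discrete Measurable.of_discrete] at h2
  exact h2

lemma noiseLaw_real_bit (hq : q ∈ Set.Icc (0 : ℝ) 1) (j : Fin m) (s : Fin n) (b : Bool) :
    (noiseLaw q m n).real {ν | ν j s = b} = if b then q else 1 - q := by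
  have := isProbabilityMeasure_bitLaw hq
  have h1 : MeasurePreserving (Function.eval j) (noiseLaw q m n)
      (Measure.pi fun _ : Fin n => bitLaw q) := measurePreserving_eval _ j
  have h2 : MeasurePreserving (Function.eval s) (Measure.pi fun _ : Fin n => bitLaw q)
    (bitLaw q) := measurePreserving_eval _ s
  have h3 := (h2.comp h1).measure_preimage (s := ({b} : Set Bool))
    (measurableSet_singleton b).nullMeasurableSet
  have h4 : (Function.eval s ∘ Function.eval j) ⁻¹' ({b} : Set Bool) =
    {ν : Fin m → Fin n → Bool | ν j s = b} := rfl
  rw [h4] at h3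
  rw [Measure.real, h3, bitLaw_singleton, ENNReal.toReal_ofReal]
  split_ifs <;> linarith [hq.1, hq.2]

lemma indepFun_bits (hq : q ∈ Set.Icc (0 : ℝ) 1) {j j' : Fin m} (hj : j ≠ j') (s : Fin n) :
    IndepFun (fun ν => ν j s) (fun ν => ν j' s) (noiseLaw q m n) :=
  ((iIndepFun_rows hq).indepFun hj).comp (φ := fun r => r s) (ψ := fun r => r s)
    Measurable.of_discrete Measurable.of_discrete

/-- Two noise bits differ with probability `2 q (1 - q)`. -/
lemma noiseLaw_real_bit_ne (hq : q ∈ Set.Icc (0 : ℝ) 1) {j j' : Fin m} (hj : j ≠ j') (s : Fin n) :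
    (noiseLaw q m n).real {ν | ν j s ≠ ν j' s} = 2 * (q * (1 - q)) := by
  have := isProbabilityMeasure_noiseLaw hq m n
  have h : ∀ b b' : Bool, (noiseLaw q m n).real ({ν | ν j s = b} ∩ {ν | ν j' s = b'}) =
      (if b then q else 1 - q) * (if b' then q else 1 - q) := fun b b' => by
    rw [← noiseLaw_real_bit hq j s b, ← noiseLaw_real_bit hq j' s b']
    simp only [Measure.real, ← ENNReal.toReal_mul]
    congr 1
    exact (indepFun_bits hq hj s).measure_inter_preimage_eq_mul {b} {b'}
      (measurableSet_singleton _) (measurableSet_singleton _)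
  have e : {ν : Fin m → Fin n → Bool | ν j s ≠ ν j' s} =
      ({ν | ν j s = true} ∩ {ν | ν j' s = false}) ∪
        ({ν | ν j s = false} ∩ {ν | ν j' s = true}) := by
    ext ν
    simp only [Set.mem_ofPred_eq, Set.mem_union, Set.mem_inter_iff]
    cases ν j s <;> cases ν j' s <;> simp
  rw [e, measureReal_union _ (Set.toFinite _).measurableSet, h, h]
  · simp; ring
  · rw [Set.disjoint_left]
    rintro ν ⟨h1, -⟩ ⟨h2, -⟩
    simp only [Set.mem_ofPred_eq] at h1 h2
    simp [h1] at h2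

lemma noiseLaw_real_bit_eq (hq : q ∈ Set.Icc (0 : ℝ) 1) {j j' : Fin m} (hj : j ≠ j') (s : Fin n) :
    (noiseLaw q m n).real {ν | ν j s = ν j' s} = 1 - 2 * (q * (1 - q)) := by
  have := isProbabilityMeasure_noiseLaw hq m n
  rw [← noiseLaw_real_bit_ne hq hj s, ← probReal_compl_eq_one_sub (Set.toFinite _).measurableSet]
  congr 1
  ext ν
  simp

end Noise

/-- The example generated from the template `p` by switching the components selected by `ν`. -/
def flip {n : ℕ} (p ν : Fin n → Bool) : Fin n → Bool := fun s => xor (p s) (ν s)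

/-- Being an involution, `flip p` recovers the noise from the example and the example from the
noise. -/
lemma flip_flip {n : ℕ} (p ν : Fin n → Bool) : flip p (flip p ν) = ν := by
  funext s; simp [flip]

/-! ### Concentration of distances for fixed labels -/

section Concentration

variable {q : ℝ} {m n : ℕ}

lemma D_flip_flip (p p' ν ν' : Fin n → Bool) :
    D (vec (flip p ν)) (vec (flip p' ν')) =
      ∑ s, if xor (p s) (p' s) = xor (ν s) (ν' s) then 0 else 1 := by
  refine Finset.sum_congr rfl fun s _ => ?_
  cases h1 : p s <;> cases h2 : p' s <;> cases h3 : ν s <;> cases h4 : ν' s <;>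
    simp [vec, flip, h1, h2, h3, h4]

lemma D_vec_eq_card (p p' : Fin n → Bool) :
    D (vec p) (vec p') = (Finset.univ.filter fun s => p s ≠ p' s).card := by
  rw [Finset.card_filter]
  push_cast
  refine Finset.sum_congr rfl fun s _ => ?_
  cases h1 : p s <;> cases h2 : p' s <;> simp [vec, h1, h2]

/-- The event that the component `s` of two examples differs. -/
def diffEvent (p p' : Fin n → Bool) (j j' : Fin m) (s : Fin n) : Set (Fin m → Fin n → Bool) :=
  {ν | xor (p s) (p' s) ≠ xor (ν j s) (ν j' s)}

lemma D_flip_flip_eq_sum (p p' : Fin n → Bool) (j j' : Fin m) (ν : Fin m → Fin n → Bool) :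
    D (vec (flip p (ν j))) (vec (flip p' (ν j'))) =
      ∑ s, (diffEvent p p' j j' s).indicator (1 : (Fin m → Fin n → Bool) → ℝ) ν := by
  rw [D_flip_flip]
  refine Finset.sum_congr rfl fun s _ => ?_
  by_cases h : xor (p s) (p' s) = xor (ν j s) (ν j' s) <;> simp [diffEvent, h]

lemma iIndepFun_diffEvent (hq : q ∈ Set.Icc (0 : ℝ) 1) (p p' : Fin n → Bool) (j j' : Fin m) :
    iIndepFun (fun s => (diffEvent p p' j j' s).indicator (1 : (Fin m → Fin n → Bool) → ℝ)) (noiseLaw q m n) := by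
  classical
  have := (iIndepFun_columns (m := m) (n := n) hq).comp
    (fun s (r : Fin m → Bool) => if xor (p s) (p' s) ≠ xor (r j) (r j') then (1 : ℝ) else 0)
    fun _ => Measurable.of_discrete
  convert this using 2 with s
  funext ν
  by_cases h : xor (p s) (p' s) = xor (ν j s) (ν j' s) <;> simp [diffEvent, h]

lemma noiseLaw_real_diffEvent (hq : q ∈ Set.Icc (0 : ℝ) 1) (p p' : Fin n → Bool) {j j' : Fin m}
    (hj : j ≠ j') (s : Fin n) : (noiseLaw q m n).real (diffEvent p p' j j' s) =
      if p s = p' s then 2 * (q * (1 - q)) else 1 - 2 * (q * (1 - q)) := by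
  split_ifs with h
  · rw [← noiseLaw_real_bit_ne hq hj s]
    congr 1; ext ν
    simp only [diffEvent, h, Set.mem_ofPred_eq]
    cases ν j s <;> cases ν j' s <;> simp
  · rw [← noiseLaw_real_bit_eq hq hj s]
    congr 1; ext ν
    have : xor (p s) (p' s) = true := by
      cases h1 : p s <;> cases h2 : p' s <;> simp_all
    simp only [diffEvent, this, Set.mem_ofPred_eq]
    cases ν j s <;> cases ν j' s <;> simp

/-- Where the templates disagree, the probability `2 q (1 - q)` of a difference grows by `1 - 4 q (1
- q) = (1 - 2 q) ^ 2`. -/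
lemma sum_noiseLaw_real_diffEvent (hq : q ∈ Set.Icc (0 : ℝ) 1) (p p' : Fin n → Bool)
    {j j' : Fin m} (hj : j ≠ j') :
    ∑ s, (noiseLaw q m n).real (diffEvent p p' j j' s) =
      D (vec p) (vec p') * (1 - 2 * q) ^ 2 + n * (2 * (q * (1 - q))) := by
  rw [D_vec_eq_card]
  simp only [noiseLaw_real_diffEvent hq p p' hj]
  have : ∀ s, (if p s = p' s then 2 * (q * (1 - q)) else 1 - 2 * (q * (1 - q))) =
      (if p s ≠ p' s then (1 : ℝ) else 0) * (1 - 2 * q) ^ 2 + 2 * (q * (1 - q)) := fun s => by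
    by_cases h : p s = p' s
    · simp [h]
    · simp [h]; ring
  simp only [this, Finset.sum_add_distrib, ← Finset.sum_mul]
  rw [Finset.sum_boole]
  simp
  ring

/-- Two examples of the same cluster are rarely far apart. -/
lemma noiseLaw_real_same_le (hq : q ∈ Set.Ioo (0 : ℝ) 1) (p : Fin n → Bool) {j j' : Fin m}
    (hj : j ≠ j') (hn : 0 < n) {L A : ℝ} (hL : 0 < L) (hA : 0 ≤ A)
    (hA2 : A ^ 2 = 4 * (q * (1 - q)) * L) :
    (noiseLaw q m n).real {ν | n * (2 * (q * (1 - q)) + L + A) <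
      D (vec (flip p (ν j))) (vec (flip p (ν j')))} ≤ Real.exp (-(n * L)) := by
  have hq' : q ∈ Set.Icc (0 : ℝ) 1 := ⟨hq.1.le, hq.2.le⟩
  have := isProbabilityMeasure_noiseLaw hq' m n
  have hn' : (0 : ℝ) < n := by exact_mod_cast hn
  have hqq : 0 < q * (1 - q) := mul_pos hq.1 (by linarith [hq.2])
  have h := measure_sum_ge_le (iIndepFun_diffEvent (m := m) hq' p p j j')
    (fun _ => Measurable.of_discrete) (fun s t => mgf_ite_le (Set.toFinite _).measurableSet t)
    (M := n * (2 * (q * (1 - q)))) (by rw [sum_noiseLaw_real_diffEvent hq' p p hj, D_self]; ring)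
    (by positivity) (τ := n * (L + A)) (by positivity)
  refine (measureReal_mono fun ν hν => ?_).trans (h.trans (Real.exp_le_exp.2 ?_))
  · simp only [Set.mem_ofPred_eq, D_flip_flip_eq_sum] at hν ⊢
    linarith
  · rw [neg_le_neg_iff, le_div_iff₀ (by positivity)]
    -- `A ^ 2` is twice the mean per component times `L`, exactly what makes the Chernoff exponent
    -- reach `n L`.
    have : (L + A) ^ 2 = L * (2 * (2 * (q * (1 - q))) + (L + A)) + L * A := by
      linear_combination hA2
    have h2 : L * (2 * (2 * (q * (1 - q))) + (L + A)) ≤ (L + A) ^ 2 := by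
      rw [this]; have : 0 ≤ L * A := by positivity
      linarith
    calc _ = n ^ 2 * (L * (2 * (2 * (q * (1 - q))) + (L + A))) := by ring
      _ ≤ n ^ 2 * (L + A) ^ 2 := by gcongr
      _ = _ := by ring

/-- Two examples of different clusters are rarely close. -/
lemma noiseLaw_real_diff_le (hq : q ∈ Set.Ioo (0 : ℝ) 1) (p p' : Fin n → Bool) {j j' : Fin m}
    (hj : j ≠ j') (hn : 0 < n) {c γ L : ℝ} (hc : 0 < c) (hγ : 0 ≤ γ) (hγ1 : γ ≤ 1)
    (hp : c * n ≤ D (vec p) (vec p'))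
    (hL : L ≤ γ ^ 2 * (c * (1 - 2 * q) ^ 2 + 2 * (q * (1 - q))) / 2) :
    (noiseLaw q m n).real {ν | D (vec (flip p (ν j))) (vec (flip p' (ν j'))) <
      n * ((c * (1 - 2 * q) ^ 2 + 2 * (q * (1 - q))) * (1 - γ))} ≤ Real.exp (-(n * L)) := by
  have hq' : q ∈ Set.Icc (0 : ℝ) 1 := ⟨hq.1.le, hq.2.le⟩
  have := isProbabilityMeasure_noiseLaw hq' m n
  have hn' : (0 : ℝ) < n := by exact_mod_cast hn
  have hqq : 0 < q * (1 - q) := mul_pos hq.1 (by linarith [hq.2])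
  have hM : n * (c * (1 - 2 * q) ^ 2 + 2 * (q * (1 - q))) ≤
      D (vec p) (vec p') * (1 - 2 * q) ^ 2 + n * (2 * (q * (1 - q))) := by
    have := mul_le_mul_of_nonneg_right hp (sq_nonneg (1 - 2 * q))
    linarith
  have h := measure_sum_le_le (iIndepFun_diffEvent (m := m) hq' p p' j j')
    (fun _ => Measurable.of_discrete) (fun s t => mgf_ite_le (Set.toFinite _).measurableSet t)
    (sum_noiseLaw_real_diffEvent hq' p p' hj)
    (lt_of_lt_of_le (by positivity) hM) hγ
  refine (measureReal_mono fun ν hν => ?_).trans (h.trans (Real.exp_le_exp.2 ?_))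
  · simp only [Set.mem_ofPred_eq, ← D_flip_flip_eq_sum] at hν ⊢
    have := mul_le_mul_of_nonneg_right hM (sub_nonneg.2 hγ1)
    linarith
  · rw [neg_le_neg_iff]
    have := mul_le_mul_of_nonneg_left hM (sq_nonneg γ)
    have := mul_le_mul_of_nonneg_left hL hn'.le
    linarith

lemma signedGap_flip_flip (p p' ν ν' : Fin n → Bool) :
    signedGap (vec p) (vec p') (vec (flip p ν)) (vec (flip p' ν')) =
      D (vec p) (vec p') - ∑ s ∈ Finset.univ.filter (fun s => p s ≠ p' s),
        ((if ν s then 1 else 0) + (if ν' s then 1 else 0)) := by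
  rw [Finset.sum_filter, signedGap, D, ← Finset.sum_sub_distrib]
  refine Finset.sum_congr rfl fun s _ => ?_
  cases h1 : p s <;> cases h2 : p' s <;> cases h3 : ν s <;> cases h4 : ν' s <;>
    simp [vec, flip, h1, h2, h3, h4]

/-- The components that tell two templates apart rarely receive too much noise. -/
lemma noiseLaw_real_signed_le (hq : q ∈ Set.Ioo (0 : ℝ) 1) (p p' : Fin n → Bool) {j j' : Fin m}
    (hj : j ≠ j') (hn : 0 < n) {c τ L : ℝ} (hc : 0 < c) (hτ : 0 < τ) (hτ1 : 2 * q + τ ≤ 1)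
    (hp : c * n ≤ D (vec p) (vec p')) (hL : L * (4 * q + τ) ≤ c * τ ^ 2) :
    (noiseLaw q m n).real
      {ν | signedGap (vec p) (vec p') (vec (flip p (ν j))) (vec (flip p' (ν j'))) <
        n * (c * (1 - 2 * q - τ))} ≤ Real.exp (-(n * L)) := by
  classical
  have hq' : q ∈ Set.Icc (0 : ℝ) 1 := ⟨hq.1.le, hq.2.le⟩
  have := isProbabilityMeasure_noiseLaw hq' m n
  have hn' : (0 : ℝ) < n := by exact_mod_cast hn
  have hq0 := hq.1
  set S := Finset.univ.filter fun s => p s ≠ p' s with hS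
  set d := D (vec p) (vec p') with hd
  have hdS : d = (S.card : ℝ) := D_vec_eq_card p p'
  have hd0 : 0 < d := lt_of_lt_of_le (by positivity) hp
  -- Only components where the templates differ enter the signed gap, and each loses one unit per
  -- switched bit; the mean loss is `2 q` per component.
  set X : S → (Fin m → Fin n → Bool) → ℝ := fun s ν =>
    (if ν j s then 1 else 0) + (if ν j' s then 1 else 0) with hX
  have hbit : ∀ (i : Fin m) (s : Fin n) t,
      mgf (fun ν : Fin m → Fin n → Bool => if ν i s then (1 : ℝ) else 0) (noiseLaw q m n) t ≤
      Real.exp (q * (Real.exp t - 1)) := by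
    intro i s t
    have h1 := mgf_ite_le (μ := noiseLaw q m n) (A := {ν | ν i s = true})
      (Set.toFinite _).measurableSet t
    rw [noiseLaw_real_bit hq'] at h1
    simp only [if_true] at h1
    convert h1 using 2
    funext ν
    by_cases h : ν i s = true <;> simp [h]
  have hind : iIndepFun X (noiseLaw q m n) :=
    ((iIndepFun_columns (m := m) (n := n) hq').comp
      (fun s (r : Fin m → Bool) => (if r j then (1 : ℝ) else 0) + (if r j' then 1 else 0))
      fun _ => Measurable.of_discrete).precomp (g := fun s : S => (s : Fin n))
      Subtype.val_injective
  have hmgf : ∀ s t, mgf (X s) (noiseLaw q m n) t ≤ Real.exp ((2 * q) * (Real.exp t - 1)) := by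
    intro s t
    have h1 := ((indepFun_bits hq' hj (s : Fin n)).comp
      (φ := fun b : Bool => if b then (1 : ℝ) else 0)
      (ψ := fun b : Bool => if b then (1 : ℝ) else 0) Measurable.of_discrete
      Measurable.of_discrete).mgf_add (t := t) Measurable.of_discrete.aestronglyMeasurable
      Measurable.of_discrete.aestronglyMeasurable
    refine (le_of_eq h1).trans ((mul_le_mul (hbit j s t) (hbit j' s t) mgf_nonneg
      (Real.exp_pos _).le).trans (le_of_eq ?_))
    rw [← Real.exp_add]; congr 1; ring
  have h := measure_sum_ge_le hind (fun _ => Measurable.of_discrete) hmgf (M := d * (2 * q))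
    (by simp [hdS]) (by positivity) (τ := d * τ) (by positivity)
  refine (measureReal_mono fun ν hν => ?_).trans (h.trans (Real.exp_le_exp.2 ?_))
  · simp only [Set.mem_ofPred_eq, signedGap_flip_flip] at hν ⊢
    have e : ∑ s, X s ν = ∑ s ∈ S, ((if ν j s then (1 : ℝ) else 0) + (if ν j' s then 1 else 0)) :=
      Finset.sum_coe_sort S
        (fun s => ((if ν j s then (1 : ℝ) else 0) + (if ν j' s then 1 else 0)))
    rw [e]
    have := mul_le_mul_of_nonneg_right hp (show 0 ≤ 1 - 2 * q - τ by linarith)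
    linarith
  · rw [neg_le_neg_iff, le_div_iff₀ (by positivity)]
    have h1 := mul_le_mul_of_nonneg_left hL (mul_pos hn' hd0).le
    have h2 := mul_le_mul_of_nonneg_right hp (mul_pos hd0 (pow_pos hτ 2)).le
    linarith

/-- Chebyshev bound for the distance of two examples of the same cluster. -/
lemma noiseLaw_real_pair_le (hq : q ∈ Set.Ioo (0 : ℝ) 1) (p : Fin n → Bool) {j j' : Fin m}
    (hj : j ≠ j') (hn : 0 < n) :
    (noiseLaw q m n).real {ν | n * ((1 - q) * (4 * q + √q)) / 2 <
      D (vec (flip p (ν j))) (vec (flip p (ν j')))} ≤ 8 / ((1 - q) * n) := by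
  have hq' : q ∈ Set.Icc (0 : ℝ) 1 := ⟨hq.1.le, hq.2.le⟩
  have := isProbabilityMeasure_noiseLaw hq' m n
  have hn' : (0 : ℝ) < n := by exact_mod_cast hn
  have hq0 := hq.1
  have h1q : 0 < 1 - q := by linarith [hq.2]
  -- The mean `2 n q (1 - q)` plus this deviation is exactly `n (1 - q) (4 q + √q) / 2`.
  have h := measure_count_ge_le (iIndepFun_diffEvent (m := m) hq' p p j j')
    (r := 2 * (q * (1 - q)))
    (fun s => by rw [noiseLaw_real_diffEvent hq' p p hj, if_pos rfl])
    (τ := n * ((1 - q) * √q) / 2) (by positivity)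
  rw [Fintype.card_fin] at h
  refine (measureReal_mono fun ν hν => ?_).trans (h.trans (le_of_eq ?_))
  · simp only [Set.mem_ofPred_eq, D_flip_flip_eq_sum] at hν ⊢
    linarith
  · have e : (n * ((1 - q) * √q) / 2) ^ 2 = n ^ 2 * (1 - q) ^ 2 * q / 4 := by
      rw [div_pow, mul_pow, mul_pow, Real.sq_sqrt hq0.le]; ring
    rw [e]
    field_simp
    norm_num

/-- Two disjoint pairs of examples are independent. -/
lemma noiseLaw_real_two_pairs_le (hq : q ∈ Set.Ioo (0 : ℝ) 1) (p p' : Fin n → Bool)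
    {j₁ j₂ j₃ j₄ : Fin m} (h₁₂ : j₁ ≠ j₂) (h₃₄ : j₃ ≠ j₄) (h₁₃ : j₁ ≠ j₃) (h₁₄ : j₁ ≠ j₄)
    (h₂₃ : j₂ ≠ j₃) (h₂₄ : j₂ ≠ j₄) (hn : 0 < n) :
    (noiseLaw q m n).real {ν |
      n * ((1 - q) * (4 * q + √q)) / 2 < D (vec (flip p (ν j₁))) (vec (flip p (ν j₂))) ∧
      n * ((1 - q) * (4 * q + √q)) / 2 < D (vec (flip p' (ν j₃))) (vec (flip p' (ν j₄)))} ≤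
      (8 / ((1 - q) * n)) ^ 2 := by
  have hq' : q ∈ Set.Icc (0 : ℝ) 1 := ⟨hq.1.le, hq.2.le⟩
  have := isProbabilityMeasure_noiseLaw hq' m n
  have hind := (iIndepFun_rows (m := m) (n := n) hq').indepFun_prodMk_prodMk
    (fun _ => Measurable.of_discrete) j₁ j₂ j₃ j₄ h₁₃ h₁₄ h₂₃ h₂₄
  have h := hind.measure_inter_preimage_eq_mul
    {r | n * ((1 - q) * (4 * q + √q)) / 2 < D (vec (flip p r.1)) (vec (flip p r.2))}
    {r | n * ((1 - q) * (4 * q + √q)) / 2 < D (vec (flip p' r.1)) (vec (flip p' r.2))}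
    (Set.toFinite _).measurableSet (Set.toFinite _).measurableSet
  have h2 := congrArg ENNReal.toReal h
  rw [ENNReal.toReal_mul] at h2
  rw [sq]
  refine (le_of_eq h2).trans (mul_le_mul (noiseLaw_real_pair_le hq p h₁₂ hn)
    (noiseLaw_real_pair_le hq p' h₃₄ hn) ENNReal.toReal_nonneg ?_)
  exact div_nonneg (by norm_num) (mul_nonneg (by linarith [hq.2]) (Nat.cast_nonneg n))

end Concentration

/-! ### Joint law of initial indices, labels and noise -/

section JointLaw

variable {Ω : Type*} [MeasurableSpace Ω] {μ : Measure Ω} [IsProbabilityMeasure μ] {k n m l : ℕ}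
  {w : Fin k → ℝ} {q : ℝ} {P : Fin k → Fin n → Bool} {z : Fin m → Ω → Fin k}
  {x : Fin m → Ω → Fin n → Bool} {init : Ω → Fin l → Fin m}

lemma sum_noiseProb (q : ℝ) (p : Fin n → Bool) : ∑ y, noiseProb q p y = 1 := by
  unfold noiseProb
  have := Finset.prod_univ_sum (fun _ : Fin n => (Finset.univ : Finset Bool))
    (fun s b => if b = p s then 1 - q else q)
  rw [Fintype.piFinset_univ] at this
  rw [← this]
  refine Finset.prod_eq_one fun s _ => ?_
  cases p s <;> simp

lemma noiseProb_flip (q : ℝ) (p ν : Fin n → Bool) :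
    noiseProb q p (flip p ν) = ∏ s, if ν s then q else 1 - q := by
  refine Finset.prod_congr rfl fun s _ => ?_
  cases h1 : p s <;> cases h2 : ν s <;> simp [flip, h1, h2]

namespace IsMixtureSample

variable (h : IsMixtureSample μ w q P z x init)
include h

lemma real_label (j : Fin m) (a : Fin k) : μ.real {ω | z j ω = a} = w a := by
  have e : {ω | z j ω = a} = ⋃ y ∈ (Finset.univ : Finset (Fin n → Bool)),
      {ω | z j ω = a ∧ x j ω = y} := by
    ext ω; simp
  rw [e, measureReal_biUnion_finset]
  · simp only [h.law, ← Finset.mul_sum, sum_noiseProb, mul_one]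
  · intro y _ y' _ hy
    rw [Function.onFun, Set.disjoint_left]
    rintro ω ⟨-, h1⟩ ⟨-, h2⟩
    exact hy (h1.symm.trans h2)
  · intro y _
    exact (h.measurable_label j (measurableSet_singleton a)).inter
      (h.measurable_example j (measurableSet_singleton y))

lemma weight_nonneg (j : Fin m) (a : Fin k) : 0 ≤ w a := by
  rw [← h.real_label j a]; exact measureReal_nonneg

omit [IsProbabilityMeasure μ] in
lemma measurable_data : Measurable fun ω j => (z j ω, x j ω) :=
  measurable_pi_lambda _ fun j => (h.measurable_label j).prodMk (h.measurable_example j)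

/-- Labels and noise are independent of each other and of the choice of the initial templates. -/
lemma map_joint (hq : q ∈ Set.Icc (0 : ℝ) 1) :
    μ.map (fun ω => (init ω, (fun j => z j ω), fun j => flip (P (z j ω)) (x j ω))) =
      (μ.map init).prod ((Measure.pi fun j => μ.map (z j)).prod (noiseLaw q m n)) := by
  have := isProbabilityMeasure_noiseLaw hq m n
  have : ∀ j, IsProbabilityMeasure (μ.map (z j)) := fun j =>
    Measure.isProbabilityMeasure_map (h.measurable_label j).aemeasurable
  have : IsProbabilityMeasure (μ.map init) :=
    Measure.isProbabilityMeasure_map h.measurable_init.aemeasurable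
  have hmeas : Measurable
      (fun ω => (init ω, (fun j => z j ω), fun j => flip (P (z j ω)) (x j ω))) :=
    (Measurable.of_discrete (f := fun r : (Fin l → Fin m) × (Fin m → Fin k × (Fin n → Bool)) =>
      (r.1, (fun j => (r.2 j).1), fun j => flip (P (r.2 j).1) (r.2 j).2))).comp
      (h.measurable_init.prodMk h.measurable_data)
  refine Measure.ext_of_singleton fun ⟨e, ζ, ν⟩ => ?_
  rw [Measure.map_apply hmeas (measurableSet_singleton _)]
  -- For fixed labels, prescribing the noise is the same as prescribing the examples.
  have e1 : (fun ω => (init ω, (fun j => z j ω), fun j => flip (P (z j ω)) (x j ω))) ⁻¹'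
      {(e, ζ, ν)} = init ⁻¹' {e} ∩ (fun ω j => (z j ω, x j ω)) ⁻¹'
        {fun j => (ζ j, flip (P (ζ j)) (ν j))} := by
    ext ω
    simp only [Set.mem_preimage, Set.mem_singleton_iff, Prod.mk.injEq, Set.mem_inter_iff,
      funext_iff (f := fun j => (z j ω, x j ω)), funext_iff (f := fun j => z j ω),
      funext_iff (f := fun j => flip (P (z j ω)) (x j ω)), ← forall_and]
    refine and_congr_right fun _ => forall_congr' fun j => and_congr_right fun hj => ?_
    rw [hj]
    exact ⟨fun h => by rw [← h, flip_flip], fun h => by rw [h, flip_flip]⟩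
  rw [e1, h.indep_init.measure_inter_preimage_eq_mul _ _ (measurableSet_singleton _)
    (measurableSet_singleton _), ← Set.singleton_prod_singleton, ← Set.singleton_prod_singleton,
    Measure.prod_prod, Measure.prod_prod, Measure.map_apply h.measurable_init
    (measurableSet_singleton _)]
  congr 1
  rw [← Measure.map_apply h.measurable_data (measurableSet_singleton _),
    h.indep.map_fun_eq_pi_map fun j =>
      ((h.measurable_label j).prodMk (h.measurable_example j)).aemeasurable]
  have : ∀ j, IsProbabilityMeasure (μ.map fun ω => (z j ω, x j ω)) := fun j =>
    Measure.isProbabilityMeasure_map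
      ((h.measurable_label j).prodMk (h.measurable_example j)).aemeasurable
  rw [Measure.pi_singleton, Measure.pi_singleton, noiseLaw_singleton hq, ← Finset.prod_mul_distrib]
  refine Finset.prod_congr rfl fun j _ => ?_
  rw [Measure.map_apply ((h.measurable_label j).prodMk (h.measurable_example j))
    (measurableSet_singleton _), Measure.map_apply (h.measurable_label j)
    (measurableSet_singleton _)]
  have e2 : (fun ω => (z j ω, x j ω)) ⁻¹' {(ζ j, flip (P (ζ j)) (ν j))} =
      {ω | z j ω = ζ j ∧ x j ω = flip (P (ζ j)) (ν j)} := by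
    ext ω; simp
  have e3 : z j ⁻¹' {ζ j} = {ω | z j ω = ζ j} := rfl
  have hpos : ∀ s ∈ (Finset.univ : Finset (Fin n)), 0 ≤ if ν j s then q else 1 - q := fun s _ => by
    split_ifs <;> linarith [hq.1, hq.2]
  rw [e2, e3, ← ofReal_measureReal, ← ofReal_measureReal, h.law, h.real_label, noiseProb_flip,
    ENNReal.ofReal_mul (h.weight_nonneg j _), ENNReal.ofReal_prod_of_nonneg hpos]

/-- `law_init` prescribes only the probabilities of injective choices, but there are
`m.descFactorial l` of them, so these probabilities already add up to one. -/
lemma ae_injective (hlm : l ≤ m) : ∀ᵐ e ∂(μ.map init), Function.Injective e := by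
  classical
  have hmi := h.measurable_init
  rw [ae_iff, Measure.map_apply hmi (Set.toFinite _).measurableSet]
  have e1 : init ⁻¹' {e | ¬Function.Injective e} =
      (⋃ e ∈ Finset.univ.filter (fun e : Fin l → Fin m => Function.Injective e),
        {ω | init ω = e})ᶜ := by
    ext ω
    simp only [Set.mem_preimage, Set.mem_ofPred_eq, Set.mem_compl_iff, Set.mem_iUnion,
      Finset.mem_filter, Finset.mem_univ, true_and, exists_prop, not_exists, not_and]
    exact ⟨fun h i hi he => h (he ▸ hi), fun h hi => h _ hi rfl⟩
  rw [e1, prob_compl_eq_zero_iff]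
  · have h2 : μ.real (⋃ e ∈ Finset.univ.filter (fun e : Fin l → Fin m => Function.Injective e),
        {ω | init ω = e}) = 1 := by
      rw [measureReal_biUnion_finset]
      · rw [Finset.sum_congr rfl fun e he => h.law_init e (by simpa using he)]
        have hcard : (Finset.univ.filter
            (fun e : Fin l → Fin m => Function.Injective e)).card = m.descFactorial l := by
          have h3 := Fintype.card_embedding_eq (α := Fin l) (β := Fin m)
          rw [Fintype.card_fin, Fintype.card_fin] at h3
          rw [← h3, ← Fintype.card_subtype]
          exact Fintype.card_congr (Equiv.subtypeInjectiveEquivEmbedding _ _)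
        rw [Finset.sum_const, hcard, nsmul_eq_mul]
        have : (m.descFactorial l : ℝ) ≠ 0 := by
          exact_mod_cast (Nat.descFactorial_pos.2 hlm).ne'
        field_simp
      · intro e _ e' _ he
        rw [Function.onFun, Set.disjoint_left]
        exact fun ω h1 h2 => he (h1.symm.trans h2)
      · exact fun e _ => hmi (measurableSet_singleton e)
    rw [← ofReal_measureReal (measure_ne_top _ _), h2, ENNReal.ofReal_one]
  · exact Finset.measurableSet_biUnion _ fun e _ => hmi (measurableSet_singleton e)

/-- To bound the probability of an event it suffices to bound it over the noise, for fixed labels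
and initial examples. -/
lemma real_le_of_noise (hq : q ∈ Set.Icc (0 : ℝ) 1) (hlm : l ≤ m) {β : ℝ}
    (A : (Fin l → Fin m) → (Fin m → Fin k) → (Fin m → Fin n → Bool) → Prop)
    (hA : ∀ e ζ, Function.Injective e → (noiseLaw q m n).real {ν | A e ζ ν} ≤ β) :
    μ.real {ω | A (init ω) (fun j => z j ω) (fun j => flip (P (z j ω)) (x j ω))} ≤ β := by
  have := isProbabilityMeasure_noiseLaw hq m n
  have : ∀ j, IsProbabilityMeasure (μ.map (z j)) := fun j =>
    Measure.isProbabilityMeasure_map (h.measurable_label j).aemeasurable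
  have : IsProbabilityMeasure (μ.map init) :=
    Measure.isProbabilityMeasure_map h.measurable_init.aemeasurable
  have hmeas : Measurable
      (fun ω => (init ω, (fun j => z j ω), fun j => flip (P (z j ω)) (x j ω))) :=
    (Measurable.of_discrete (f := fun r : (Fin l → Fin m) × (Fin m → Fin k × (Fin n → Bool)) =>
      (r.1, (fun j => (r.2 j).1), fun j => flip (P (r.2 j).1) (r.2 j).2))).comp
      (h.measurable_init.prodMk h.measurable_data)
  have h1 : μ {ω | A (init ω) (fun j => z j ω) (fun j => flip (P (z j ω)) (x j ω))} =
      μ.map (fun ω => (init ω, (fun j => z j ω), fun j => flip (P (z j ω)) (x j ω)))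
        {r | A r.1 r.2.1 r.2.2} := by
    rw [Measure.map_apply hmeas (Set.toFinite _).measurableSet]; rfl
  have hβ : μ {ω | A (init ω) (fun j => z j ω) (fun j => flip (P (z j ω)) (x j ω))} ≤
      ENNReal.ofReal β := by
    rw [h1, h.map_joint hq, Measure.prod_apply (Set.toFinite _).measurableSet]
    calc _ ≤ ∫⁻ _e, ENNReal.ofReal β ∂(μ.map init) := by
          refine lintegral_mono_ae ?_
          filter_upwards [h.ae_injective hlm] with e he
          rw [Measure.prod_apply (Set.toFinite _).measurableSet]
          calc _ ≤ ∫⁻ _ζ, ENNReal.ofReal β ∂(Measure.pi fun j => μ.map (z j)) := by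
                refine lintegral_mono fun ζ => ?_
                have := hA e ζ he
                rw [← ofReal_measureReal]
                exact ENNReal.ofReal_le_ofReal this
            _ = _ := by simp
      _ = _ := by simp
  -- `ENNReal.ofReal` would truncate a negative `β`; an injective choice exists because `l ≤ m`, so
  -- `β` bounds a probability.
  have hβ0 : 0 ≤ β := by
    obtain ⟨e, he⟩ : ∃ e : Fin l → Fin m, Function.Injective e :=
      ⟨Fin.castLE hlm, Fin.castLE_injective hlm⟩
    obtain ⟨ω⟩ := Measure.nonempty_of_neZero μ
    exact measureReal_nonneg.trans (hA e (fun j => z j ω) he)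
  exact ENNReal.toReal_le_of_le_ofReal hβ0 hβ

/-- To bound the probability of an event that depends on the labels and the initial examples it
suffices to bound it over the labels, for fixed initial examples. -/
lemma real_le_of_labels (hlm : l ≤ m) {β : ℝ}
    (A : (Fin l → Fin m) → (Fin m → Fin k) → Prop)
    (hA : ∀ e, Function.Injective e → (Measure.pi fun j => μ.map (z j)).real {ζ | A e ζ} ≤ β) :
    μ.real {ω | A (init ω) (fun j => z j ω)} ≤ β := by
  have : ∀ j, IsProbabilityMeasure (μ.map (z j)) := fun j =>
    Measure.isProbabilityMeasure_map (h.measurable_label j).aemeasurable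
  have : IsProbabilityMeasure (μ.map init) :=
    Measure.isProbabilityMeasure_map h.measurable_init.aemeasurable
  have hz : Measurable fun ω j => z j ω := measurable_pi_lambda _ h.measurable_label
  have hind : IndepFun init (fun ω j => z j ω) μ :=
    h.indep_init.comp (φ := id)
      (ψ := fun (r : Fin m → Fin k × (Fin n → Bool)) j => (r j).1) measurable_id Measurable.of_discrete
  have hlaw : μ.map (fun ω j => z j ω) = Measure.pi fun j => μ.map (z j) :=
    (h.indep.comp (fun _ r => r.1) fun _ => measurable_fst).map_fun_eq_pi_map
      fun j => (h.measurable_label j).aemeasurable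
  have hjoint := (indepFun_iff_map_prod_eq_prod_map_map h.measurable_init.aemeasurable
    hz.aemeasurable).1 hind
  have h1 : μ {ω | A (init ω) (fun j => z j ω)} =
      μ.map (fun ω => (init ω, fun j => z j ω)) {r | A r.1 r.2} := by
    rw [Measure.map_apply (h.measurable_init.prodMk hz) (Set.toFinite _).measurableSet]; rfl
  have hβ : μ {ω | A (init ω) (fun j => z j ω)} ≤ ENNReal.ofReal β := by
    rw [h1, hjoint, hlaw, Measure.prod_apply (Set.toFinite _).measurableSet]
    calc _ ≤ ∫⁻ _e, ENNReal.ofReal β ∂(μ.map init) := by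
          refine lintegral_mono_ae ?_
          filter_upwards [h.ae_injective hlm] with e he
          have := hA e he
          rw [← ofReal_measureReal]
          exact ENNReal.ofReal_le_ofReal this
      _ = _ := by simp
  have hβ0 : 0 ≤ β := measureReal_nonneg.trans (hA _ (Fin.castLE_injective hlm))
  exact ENNReal.toReal_le_of_le_ofReal hβ0 hβ

end IsMixtureSample

end JointLaw

/-- `succeeds_of_concentrated` for the thresholds at which concentration holds. -/
theorem succeeds_of_thresholds {k n m l : ℕ} {w : Fin k → ℝ} {wmin q c ε e L A γ τ : ℝ}
    {P : Fin k → Fin n → Bool} {z : Fin m → Fin k} {y : Fin m → Fin n → Bool}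
    {init : Fin l → Fin m} (hq : q ∈ Set.Ioo (0 : ℝ) (1 / 2)) (hB : 0 < B q)
    (hε : ε ∈ Set.Ioo (0 : ℝ) 1) (hwmin : 0 < wmin) (hw : ∀ i, wmin ≤ w i)
    (hkw : k * wmin ≤ 1) (hk : 2 ≤ k) (hc0 : 0 < c) (hc1 : c ≤ 1) (hm : 0 < m) (hn : 576 ≤ n)
    (hnc : 288 ≤ n * c) (hl : (l : ℝ) ≤ n / wmin ^ 2) (hT : Thresholds q c e L A γ τ)
    (hcB : 4 / (n * B q) * Real.log (5 * n / (ε * wmin)) < c)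
    (hsize : ∀ a, m * w a * (1 - 1 / 2) < (Finset.univ.filter fun j => z j = a).card)
    (hhit : ∀ a, 0 < (Finset.univ.filter fun i => z (init i) = a).card)
    (hinit : ∀ a, ((Finset.univ.filter fun i => z (init i) = a).card : ℝ) <
      l * w a + 0.9 * (l * w a))
    (hpair : ∃ i i', i ≠ i' ∧ D (vec (y (init i))) (vec (y (init i'))) ≤
      n * ((1 - q) * (4 * q + √q)) / 2)
    (hsame : ∀ j j', j ≠ j' → z j = z j' → D (vec (y j)) (vec (y j')) ≤
      n * (2 * (q * (1 - q)) + L + A))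
    (hdiff : ∀ j j', j ≠ j' → z j ≠ z j' →
      n * ((c * (1 - 2 * q) ^ 2 + 2 * (q * (1 - q))) * (1 - γ)) ≤ D (vec (y j)) (vec (y j')))
    (hsigned : ∀ j j', j ≠ j' → z j ≠ z j' → n * (c * (1 - 2 * q - τ)) ≤
      signedGap (vec (P (z j))) (vec (P (z j'))) (vec (y j)) (vec (y j'))) :
    Succeeds P (ε * q) z y init := by
  have hn' : (576 : ℝ) ≤ n := by exact_mod_cast hn
  have hn0 : (0 : ℝ) < n := by linarith
  have hm' : (0 : ℝ) < m := by exact_mod_cast hm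
  have hq0 := hq.1
  have hq1 := noise_lt hq hB
  have hqq : 0 < q * (1 - q) := mul_pos hq0 (by linarith)
  have hR0 := ratioBound_pos hq
  have hR1 := ratioBound_lt_one hq hB
  set R := (1 - q) * (4 * q + √q) with hR
  -- `288 * (1 - 2 * 0.21) > 160`.
  have hb : 160 ≤ c * (1 - 2 * q) * n := by nlinarith
  obtain ⟨h1, h2⟩ := contamination_bounds (b := c * (1 - 2 * q) * n) hR0 hR1
    (ratioBound_sq_le hq hB) hε hwmin hk hkw hq (by omega) hb
    (ratioBound_rpow_le hq hB (by omega) hε.1 hwmin hcB) hl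
  set κ := 4 * (l : ℝ) * R ^ (0.28 * (c * (1 - 2 * q) * n)) with hκ
  have hκ0 : 0 ≤ κ := by positivity
  have hu : 0 ≤ n * (2 * (q * (1 - q)) + L + A) := by
    have := hT.L_pos; have := hT.A_nonneg; positivity
  have hM1 : c * (1 - 2 * q) ^ 2 + 2 * (q * (1 - q)) ≤ 1 := by
    have := mul_le_mul_of_nonneg_right hc1 (sq_nonneg (1 - 2 * q))
    linarith
  have hM0 : 0 ≤ c * (1 - 2 * q) ^ 2 + 2 * (q * (1 - q)) := by positivity
  refine succeeds_of_concentrated (u := n * (2 * (q * (1 - q)) + L + A))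
    (v := n * ((c * (1 - 2 * q) ^ 2 + 2 * (q * (1 - q))) * (1 - γ)))
    (g := n * (c * (1 - 2 * q - τ))) (R := R) (Δ := 0.28 * (c * (1 - 2 * q) * n))
    (κ := κ) (wmin := wmin) (by omega) hm (by omega) hR0 hR1 hu ?_ ?_ ?_ hwmin
    (mul_pos hε.1 hq0) hκ ?_ ?_ ?_ h2 ?_ ?_ ?_ ?_ ?_ ?_ hpair
  · have : (c * (1 - 2 * q) ^ 2 + 2 * (q * (1 - q))) * (1 - γ) ≤ 1 :=
      mul_le_one₀ hM1 (by linarith [hT.γ_le_one]) (by linarith [hT.γ_nonneg])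
    nlinarith
  · have : c * (1 - 2 * q - τ) ≤ 1 :=
      mul_le_one₀ hc1 (by linarith [hT.τ_le]) (by linarith [hT.τ_pos])
    nlinarith
  · have := mul_le_mul_of_nonneg_left hT.gap hn0.le
    linarith
  · nlinarith
  -- The margin `0.1 c n ≥ 28.8` exceeds `6 κ n ≤ 0.96`.
  · have := mul_le_mul_of_nonneg_left hT.signed_gap hn0.le
    linarith
  · linarith
  · intro j j' hj
    rcases eq_or_ne j j' with rfl | hne
    · rw [D_self]; exact hu
    · exact hsame j j' hne hj
  · exact fun j j' hj => hdiff j j' (fun h => hj (by rw [h])) hj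
  · exact fun j j' hj => hsigned j j' (fun h => hj (by rw [h])) hj
  · intro a
    obtain ⟨i, hi⟩ := Finset.card_pos.1 (hhit a)
    exact ⟨i, by simpa using hi⟩
  -- At most `1.9 l w_a` initial examples and more than `m w_a / 2` examples have label `a`, whence
  -- `3.8`.
  · intro a
    have h3 := mul_le_mul_of_nonneg_left (hinit a).le hm'.le
    have h4 := mul_le_mul_of_nonneg_left (hsize a).le (Nat.cast_nonneg (α := ℝ) l)
    linarith
  · intro a
    have h3 := mul_le_mul_of_nonneg_left (hw a) hm'.le
    linarith [hsize a]

/-! ### Label counts and close initial pairs -/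

section Labels

variable {k m : ℕ} {W : Fin m → Measure (Fin k)} [∀ j, IsProbabilityMeasure (W j)] {a : Fin k}
  {p : ℝ}

lemma card_filter_eq_sum_indicator {r : ℕ} (f : Fin r → Fin m) (ζ : Fin m → Fin k) :
    ((Finset.univ.filter fun i => ζ (f i) = a).card : ℝ) =
      ∑ i, ({ζ | ζ (f i) = a} : Set (Fin m → Fin k)).indicator (1 : (Fin m → Fin k) → ℝ) ζ := by
  rw [Finset.card_filter]
  push_cast
  refine Finset.sum_congr rfl fun i _ => ?_
  by_cases h : ζ (f i) = a <;> simp [h]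

lemma iIndepFun_labels {r : ℕ} {f : Fin r → Fin m} (hf : Function.Injective f) :
    iIndepFun (fun i => ({ζ | ζ (f i) = a} : Set (Fin m → Fin k)).indicator
      (1 : (Fin m → Fin k) → ℝ)) (Measure.pi W) := by
  have h1 : iIndepFun (fun j (ζ : Fin m → Fin k) => if ζ j = a then (1 : ℝ) else 0)
      (Measure.pi W) :=
    iIndepFun_pi (X := fun _ b => if b = a then (1 : ℝ) else 0)
      fun _ => Measurable.of_discrete.aemeasurable
  convert h1.precomp hf using 2 with i
  funext ζ
  by_cases h : ζ (f i) = a <;> simp [h]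

lemma real_label_eq (hW : ∀ j, (W j).real {a} = p) (j : Fin m) :
    (Measure.pi W).real {ζ | ζ j = a} = p := by
  rw [← hW j, Measure.real, Measure.real]
  congr 1
  exact (measurePreserving_eval W j).measure_preimage (s := ({a} : Set (Fin k)))
    (measurableSet_singleton a).nullMeasurableSet

lemma real_card_le (hW : ∀ j, (W j).real {a} = p) {r : ℕ} (hr : 0 < r) (hp : 0 < p)
    {f : Fin r → Fin m} (hf : Function.Injective f) {γ : ℝ} (hγ : 0 ≤ γ) :
    (Measure.pi W).real {ζ | ((Finset.univ.filter fun i => ζ (f i) = a).card : ℝ) ≤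
      r * p * (1 - γ)} ≤ Real.exp (-(γ ^ 2 * (r * p) / 2)) := by
  simp only [card_filter_eq_sum_indicator]
  exact measure_sum_le_le (iIndepFun_labels hf) (fun _ => Measurable.of_discrete)
    (fun i t => mgf_ite_le (Set.toFinite _).measurableSet t)
    (by simp [real_label_eq hW]) (by positivity) hγ

lemma real_card_ge (hW : ∀ j, (W j).real {a} = p) {r : ℕ} (hr : 0 < r) (hp : 0 < p)
    {f : Fin r → Fin m} (hf : Function.Injective f) {τ : ℝ} (hτ : 0 ≤ τ) :
    (Measure.pi W).real {ζ | r * p + τ ≤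
      ((Finset.univ.filter fun i => ζ (f i) = a).card : ℝ)} ≤
      Real.exp (-(τ ^ 2 / (2 * (r * p) + τ))) := by
  simp only [card_filter_eq_sum_indicator]
  exact measure_sum_ge_le (iIndepFun_labels hf) (fun _ => Measurable.of_discrete)
    (fun i t => mgf_ite_le (Set.toFinite _).measurableSet t)
    (by simp [real_label_eq hW]) (by positivity) hτ

end Labels

/-- Pigeonhole twice: after removing the first pair, at least `k + 1` indices remain. -/
lemma exists_two_disjoint_pairs {k l : ℕ} (hl : k + 3 ≤ l) (f : Fin l → Fin k) :
    ∃ i₁ i₂ i₃ i₄, i₁ ≠ i₂ ∧ i₃ ≠ i₄ ∧ i₁ ≠ i₃ ∧ i₁ ≠ i₄ ∧ i₂ ≠ i₃ ∧ i₂ ≠ i₄ ∧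
      f i₁ = f i₂ ∧ f i₃ = f i₄ := by
  obtain ⟨i₁, i₂, h₁₂, h⟩ := Fintype.exists_ne_map_eq_of_card_lt f (by simp; omega)
  obtain ⟨i₃, h₃, i₄, h₄, h₃₄, h'⟩ := Finset.exists_ne_map_eq_of_card_lt_of_maps_to
    (s := Finset.univ \ {i₁, i₂}) (t := (Finset.univ : Finset (Fin k))) (f := f) (by
      rw [Finset.card_sdiff_of_subset (Finset.subset_univ _), Finset.card_pair h₁₂]
      simp; omega) (fun _ _ => Finset.mem_univ _)
  simp only [Finset.mem_sdiff, Finset.mem_univ, true_and, Finset.mem_insert,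
    Finset.mem_singleton, not_or] at h₃ h₄
  exact ⟨i₁, i₂, i₃, i₄, h₁₂, h₃₄, Ne.symm h₃.1, Ne.symm h₄.1, Ne.symm h₃.2, Ne.symm h₄.2, h, h'⟩

lemma noiseLaw_real_no_close_pair_le {k n m l : ℕ} {q : ℝ} (hq : q ∈ Set.Ioo (0 : ℝ) 1)
    (P : Fin k → Fin n → Bool) (hn : 0 < n) (hl : k + 3 ≤ l) {e : Fin l → Fin m}
    (he : Function.Injective e) (ζ : Fin m → Fin k) :
    (noiseLaw q m n).real {ν | ∀ i i', i ≠ i' → n * ((1 - q) * (4 * q + √q)) / 2 <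
      D (vec (flip (P (ζ (e i))) (ν (e i)))) (vec (flip (P (ζ (e i'))) (ν (e i'))))} ≤
      (8 / ((1 - q) * n)) ^ 2 := by
  have := isProbabilityMeasure_noiseLaw (q := q) ⟨hq.1.le, hq.2.le⟩ m n
  obtain ⟨i₁, i₂, i₃, i₄, h₁₂, h₃₄, h₁₃, h₁₄, h₂₃, h₂₄, h, h'⟩ :=
    exists_two_disjoint_pairs hl fun i => ζ (e i)
  refine (measureReal_mono fun ν hν => ?_).trans (noiseLaw_real_two_pairs_le hq (P (ζ (e i₁)))
    (P (ζ (e i₃))) (he.ne h₁₂) (he.ne h₃₄) (he.ne h₁₃) (he.ne h₁₄) (he.ne h₂₃) (he.ne h₂₄) hn)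
  have e₁ := hν i₁ i₂ h₁₂
  have e₂ := hν i₃ i₄ h₃₄
  rw [← h] at e₁
  rw [← h'] at e₂
  exact ⟨e₁, e₂⟩

/-- Size of the number of initial templates. -/
lemma numInit_ge {l k : ℕ} {wmin δ : ℝ} (hk : 2 ≤ k) (hwmin : 0 < wmin) (hkw : k * wmin ≤ 1)
    (hδ : δ ∈ Set.Ioo (0 : ℝ) 1) (hl : l = ⌈4 / wmin * Real.log (2 / (δ * wmin))⌉₊) :
    4 * Real.log (2 / (δ * wmin)) ≤ l * wmin ∧ k + 3 ≤ l := by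
  have hk' : (2 : ℝ) ≤ k := by exact_mod_cast hk
  have hw1 : wmin ≤ 1 / 2 := by nlinarith
  have h0 := hδ.1
  have h1 : 0 < δ * wmin := mul_pos h0 hwmin
  have h2 : 4 / wmin * Real.log (2 / (δ * wmin)) ≤ l := by rw [hl]; exact Nat.le_ceil _
  rw [div_mul_eq_mul_div, div_le_iff₀ hwmin] at h2
  -- `2 / (δ * wmin) ≥ 4 > exp 1`, as `wmin ≤ 1 / 2`. Hence `l ≥ 4 / wmin ≥ 4 k`.
  have h3 : 1 ≤ Real.log (2 / (δ * wmin)) := by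
    rw [Real.le_log_iff_exp_le (by positivity), le_div_iff₀ h1]
    nlinarith [Real.exp_one_lt_d9, hδ.2, Real.exp_pos 1]
  refine ⟨h2, ?_⟩
  have h4 : 4 * (k : ℝ) ≤ l := by
    have : 4 * (k * wmin) ≤ l * wmin := by linarith
    nlinarith
  have : 4 * k ≤ l := by exact_mod_cast h4
  omega

/-! ### Probabilities of the bad events -/

section Events

variable {Ω : Type*} [MeasurableSpace Ω] {μ : Measure Ω} [IsProbabilityMeasure μ] {k n m l : ℕ}
  {w : Fin k → ℝ} {q : ℝ} {P : Fin k → Fin n → Bool} {z : Fin m → Ω → Fin k}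
  {x : Fin m → Ω → Fin n → Bool} {init : Ω → Fin l → Fin m}

namespace IsMixtureSample

variable (h : IsMixtureSample μ w q P z x init)
include h

lemma map_label_real (j : Fin m) (a : Fin k) : (μ.map (z j)).real {a} = w a := by
  rw [map_measureReal_apply (h.measurable_label j) (measurableSet_singleton a)]
  exact h.real_label j a

lemma real_card_label_le (hlm : l ≤ m) (hm : 0 < m) {a : Fin k} (ha : 0 < w a) {γ : ℝ}
    (hγ : 0 ≤ γ) :
    μ.real {ω | ((Finset.univ.filter fun j => z j ω = a).card : ℝ) ≤ m * w a * (1 - γ)} ≤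
      Real.exp (-(γ ^ 2 * (m * w a) / 2)) := by
  have : ∀ j, IsProbabilityMeasure (μ.map (z j)) := fun j =>
    Measure.isProbabilityMeasure_map (h.measurable_label j).aemeasurable
  exact h.real_le_of_labels hlm
    (fun _ ζ => ((Finset.univ.filter fun j => ζ j = a).card : ℝ) ≤ m * w a * (1 - γ))
    fun _ _ => real_card_le (fun j => h.map_label_real j a) hm ha Function.injective_id hγ

lemma real_card_init_le (hlm : l ≤ m) (hl : 0 < l) {a : Fin k} (ha : 0 < w a) {γ : ℝ}
    (hγ : 0 ≤ γ) :
    μ.real {ω | ((Finset.univ.filter fun i => z (init ω i) ω = a).card : ℝ) ≤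
      l * w a * (1 - γ)} ≤ Real.exp (-(γ ^ 2 * (l * w a) / 2)) := by
  have : ∀ j, IsProbabilityMeasure (μ.map (z j)) := fun j =>
    Measure.isProbabilityMeasure_map (h.measurable_label j).aemeasurable
  exact h.real_le_of_labels hlm
    (fun e ζ => ((Finset.univ.filter fun i => ζ (e i) = a).card : ℝ) ≤ l * w a * (1 - γ))
    fun _ he => real_card_le (fun j => h.map_label_real j a) hl ha he hγ

lemma real_card_init_ge (hlm : l ≤ m) (hl : 0 < l) {a : Fin k} (ha : 0 < w a) {τ : ℝ}
    (hτ : 0 ≤ τ) :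
    μ.real {ω | l * w a + τ ≤ ((Finset.univ.filter fun i => z (init ω i) ω = a).card : ℝ)} ≤
      Real.exp (-(τ ^ 2 / (2 * (l * w a) + τ))) := by
  have : ∀ j, IsProbabilityMeasure (μ.map (z j)) := fun j =>
    Measure.isProbabilityMeasure_map (h.measurable_label j).aemeasurable
  exact h.real_le_of_labels hlm
    (fun e ζ => l * w a + τ ≤ ((Finset.univ.filter fun i => ζ (e i) = a).card : ℝ))
    fun _ he => real_card_ge (fun j => h.map_label_real j a) hl ha he hτ

lemma real_no_close_pair_le (hq : q ∈ Set.Ioo (0 : ℝ) 1) (hlm : l ≤ m) (hn : 0 < n)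
    (hl : k + 3 ≤ l) :
    μ.real {ω | ∀ i i', i ≠ i' → n * ((1 - q) * (4 * q + √q)) / 2 <
      D (vec (x (init ω i) ω)) (vec (x (init ω i') ω))} ≤ (8 / ((1 - q) * n)) ^ 2 := by
  have := h.real_le_of_noise ⟨hq.1.le, hq.2.le⟩ hlm
    (fun e ζ ν => ∀ i i', i ≠ i' → n * ((1 - q) * (4 * q + √q)) / 2 <
      D (vec (flip (P (ζ (e i))) (ν (e i)))) (vec (flip (P (ζ (e i'))) (ν (e i')))))
    fun e ζ he => noiseLaw_real_no_close_pair_le hq P hn hl he ζ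
  simpa only [flip_flip] using this

lemma real_distance_le (hq : q ∈ Set.Ioo (0 : ℝ) 1) (hlm : l ≤ m) (hn : 0 < n) {c e L A γ τ : ℝ}
    (hc0 : 0 < c) (hc : IsSeparated P c) (hT : Thresholds q c e L A γ τ) {j j' : Fin m}
    (hj : j ≠ j') :
    μ.real {ω | (z j ω = z j' ω ∧
        n * (2 * (q * (1 - q)) + L + A) < D (vec (x j ω)) (vec (x j' ω))) ∨
      (z j ω ≠ z j' ω ∧ D (vec (x j ω)) (vec (x j' ω)) <
        n * ((c * (1 - 2 * q) ^ 2 + 2 * (q * (1 - q))) * (1 - γ)))} ≤ Real.exp (-(n * L)) := by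
  have := h.real_le_of_noise ⟨hq.1.le, hq.2.le⟩ hlm
    (fun _ ζ ν => (ζ j = ζ j' ∧ n * (2 * (q * (1 - q)) + L + A) <
        D (vec (flip (P (ζ j)) (ν j))) (vec (flip (P (ζ j')) (ν j')))) ∨
      (ζ j ≠ ζ j' ∧ D (vec (flip (P (ζ j)) (ν j))) (vec (flip (P (ζ j')) (ν j'))) <
        n * ((c * (1 - 2 * q) ^ 2 + 2 * (q * (1 - q))) * (1 - γ))))
    (β := Real.exp (-(n * L))) fun _ ζ _ => ?_
  · simpa only [flip_flip] using this
  · by_cases hζ : ζ j = ζ j'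
    · simp only [hζ, true_and, ne_eq, not_true_eq_false, false_and, or_false]
      exact noiseLaw_real_same_le hq _ hj hn hT.L_pos hT.A_nonneg hT.A_sq
    · simp only [hζ, false_and, ne_eq, not_false_eq_true, true_and, false_or]
      exact noiseLaw_real_diff_le hq _ _ hj hn hc0 hT.γ_nonneg hT.γ_le_one (hc.le hn hζ) hT.L_le

lemma real_signed_le (hq : q ∈ Set.Ioo (0 : ℝ) 1) (hlm : l ≤ m) (hn : 0 < n) {c e L A γ τ : ℝ}
    (hc0 : 0 < c) (hc : IsSeparated P c) (hT : Thresholds q c e L A γ τ) {j j' : Fin m}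
    (hj : j ≠ j') :
    μ.real {ω | z j ω ≠ z j' ω ∧
      signedGap (vec (P (z j ω))) (vec (P (z j' ω))) (vec (x j ω)) (vec (x j' ω)) <
        n * (c * (1 - 2 * q - τ))} ≤ Real.exp (-(n * L)) := by
  have := h.real_le_of_noise ⟨hq.1.le, hq.2.le⟩ hlm
    (fun _ ζ ν => ζ j ≠ ζ j' ∧ signedGap (vec (P (ζ j))) (vec (P (ζ j')))
      (vec (flip (P (ζ j)) (ν j))) (vec (flip (P (ζ j')) (ν j'))) < n * (c * (1 - 2 * q - τ)))
    (β := Real.exp (-(n * L))) fun _ ζ _ => ?_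
  · simpa only [flip_flip] using this
  · by_cases hζ : ζ j = ζ j'
    · simp only [hζ, ne_eq, not_true_eq_false, false_and]
      simp [(Real.exp_pos _).le]
    · simp only [hζ, ne_eq, not_false_eq_true, true_and]
      exact noiseLaw_real_signed_le hq _ _ hj hn hc0 hT.τ_pos hT.τ_le (hc.le hn hζ) hT.L_mul_le

omit [IsProbabilityMeasure μ] in
lemma measurableSet_succeeds (err : ℝ) :
    MeasurableSet {ω | Succeeds P err (fun j => z j ω) (fun j => x j ω) (init ω)} :=
  (h.measurable_init.prodMk h.measurable_data) (Set.toFinite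
    {r : (Fin l → Fin m) × (Fin m → Fin k × (Fin n → Bool)) |
      Succeeds P err (fun j => (r.2 j).1) (fun j => (r.2 j).2) r.1}).measurableSet

end IsMixtureSample

end Events

/-- A single Chebyshev bound only gives `0.85 δ`, too much for the union bound; the second
independent pair contributes a further factor `10.2 / 576`. -/
lemma chebyshev_bound_sq_le {q δ : ℝ} {n k : ℕ} (hq : q < 0.21) (hn : 576 ≤ n) (hk : 2 ≤ k)
    (hδ : 0 < δ) (hnk : 6 * k / δ < n) : (8 / ((1 - q) * n)) ^ 2 ≤ δ / 50 := by
  have hn' : (576 : ℝ) ≤ n := by exact_mod_cast hn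
  have hk' : (2 : ℝ) ≤ k := by exact_mod_cast hk
  have hnpos : (0 : ℝ) < n := by linarith
  have h1 : 8 / ((1 - q) * n) ≤ 10.2 / n := by
    rw [div_le_div_iff₀ (mul_pos (by linarith) hnpos) hnpos]
    nlinarith
  have h2 : (10.2 : ℝ) / n ≤ 10.2 / 576 := by gcongr
  have h3 : 10.2 / n ≤ 10.2 / 12 * δ := by
    rw [div_lt_iff₀ hδ] at hnk
    rw [div_le_iff₀ hnpos]
    linarith
  calc (8 / ((1 - q) * n)) ^ 2 ≤ (10.2 / n) ^ 2 :=
        pow_le_pow_left₀ (div_nonneg (by norm_num) (mul_nonneg (by linarith) hnpos.le)) h1 2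
    _ = 10.2 / n * (10.2 / n) := sq _
    _ ≤ 10.2 / 576 * (10.2 / 12 * δ) := by gcongr
    _ ≤ δ / 50 := by linarith

/-- The overshoot `0.9` is large enough for `0.81 / 2.9 > 1 / 4`, and small enough that twice `1.9`
stays below the `4` of the weight threshold. -/
lemma le_upper_tail_exponent {M t : ℝ} (hM : 0 < M) (h : 4 * t ≤ M) :
    t ≤ (0.9 * M) ^ 2 / (2 * M + 0.9 * M) := by
  have : (0.9 * M) ^ 2 / (2 * M + 0.9 * M) = 0.81 / 2.9 * M := by field_simp; norm_num
  rw [this]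
  linarith

lemma card_offDiag_mul_le {m : ℕ} {δ s : ℝ} (hs : s ≤ δ / (12 * (m + 1) ^ 2)) (hs0 : 0 ≤ s) :
    ((Finset.univ.filter fun r : Fin m × Fin m => r.1 ≠ r.2).card : ℝ) * s ≤ δ / 12 := by
  have h1 : ((Finset.univ.filter fun r : Fin m × Fin m => r.1 ≠ r.2).card : ℝ) ≤
      (m + 1) ^ 2 := by
    have h2 : (Finset.univ.filter fun r : Fin m × Fin m => r.1 ≠ r.2).card ≤ m * m :=
      (Finset.card_filter_le _ _).trans (by simp)
    have h3 : ((Finset.univ.filter fun r : Fin m × Fin m => r.1 ≠ r.2).card : ℝ) ≤ m * m := by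
      exact_mod_cast h2
    linarith [Nat.cast_nonneg (α := ℝ) m]
  calc _ ≤ ((m : ℝ) + 1) ^ 2 * (δ / (12 * (m + 1) ^ 2)) := by gcongr
    _ = δ / 12 := by field_simp

end BernoulliEM

/-! ### The union bound -/

theorem theorem1 {Ω : Type*} [MeasurableSpace Ω] (μ : Measure Ω) [IsProbabilityMeasure μ]
    (k n m l : ℕ) (w : Fin k → ℝ) (wmin q c ε δ : ℝ) (P : Fin k → Fin n → Bool)
    (hq : q ∈ Set.Ioo (0 : ℝ) (1 / 2)) (hB : 0 < BernoulliEM.B q)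
    (hε : ε ∈ Set.Ioo (0 : ℝ) 1) (hδ : δ ∈ Set.Ioo (0 : ℝ) 1)
    (hwmin : 0 < wmin) (hw : ∀ i, wmin ≤ w i) (hw_sum : ∑ i, w i = 1)
    (hc : BernoulliEM.IsSeparated P c)
    (z : Fin m → Ω → Fin k) (x : Fin m → Ω → Fin n → Bool) (init : Ω → Fin l → Fin m)
    (hsample : BernoulliEM.IsMixtureSample μ w q P z x init)
    (h_l : l = ⌈4 / wmin * Real.log (2 / (δ * wmin))⌉₊)
    (h_m : max (8 * (l : ℝ)) (max (16 * Real.log n) (8 / wmin * Real.log (12 * k / δ))) ≤ m)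
    (h_c : max (4 / (n * BernoulliEM.B q) * Real.log (5 * n / (ε * wmin)))
        (max (max (3 * (1 - 2 * q)) 2 / (3 * (1 - 2 * q)) * (4 * q + 8 * √(6 * q * l / n)))
          (Real.log (16 * l / min (6 * n * q) 1) / (n * BernoulliEM.B q * (1 - 2 * q)))) < c)
    (h_n : max (3 / (min c 0.5 * BernoulliEM.E q c l n ^ 2) * Real.log (12 * (m + 1) ^ 2 / δ))
        (6 * k / δ) < n) :
    1 - δ ≤ μ.real {ω | BernoulliEM.Succeeds P (ε * q) (fun j => z j ω) (fun j => x j ω)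
      (init ω)} := by
  classical
  have hk := hc.two_le
  have hk' : (2 : ℝ) ≤ k := by exact_mod_cast hk
  have hδ0 := hδ.1
  have hkw : k * wmin ≤ 1 := by
    rw [← hw_sum]
    simpa using Finset.sum_le_sum fun i (_ : i ∈ Finset.univ) => hw i
  have hw0 : ∀ a, 0 < w a := fun a => hwmin.trans_le (hw a)
  have hwmin1 : wmin ≤ 1 / 2 := by nlinarith
  have hq' : q ∈ Set.Ioo (0 : ℝ) 1 := ⟨hq.1, by linarith [hq.2]⟩
  have hq1 := BernoulliEM.noise_lt hq hB
  obtain ⟨hl4, hlk⟩ := BernoulliEM.numInit_ge hk hwmin hkw hδ h_l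
  simp only [max_lt_iff] at h_c h_n
  simp only [max_le_iff] at h_m
  obtain ⟨hm8, -, hmw⟩ := h_m
  obtain ⟨hcB, hcq, -⟩ := h_c
  obtain ⟨hnE, hnk⟩ := h_n
  have hm8' : 8 * l ≤ m := by exact_mod_cast hm8
  have hlm : l ≤ m := by omega
  have hm0 : 0 < m := by omega
  have hl0 : 0 < l := by omega
  have hnpos : (0 : ℝ) < n := lt_trans (by positivity) hnk
  have hn0 : 0 < n := by exact_mod_cast hnpos
  have hc0 : 0 < c := by
    refine lt_trans (mul_pos (div_pos (by norm_num) (mul_pos hnpos hB)) (Real.log_pos ?_)) hcB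
    rw [lt_div_iff₀ (mul_pos hε.1 hwmin)]
    have h1 : (1 : ℝ) ≤ n := by exact_mod_cast hn0
    nlinarith [hε.1, hε.2]
  obtain ⟨hE0, hE1, hE2, hE3⟩ := BernoulliEM.E_bounds hq.1 hq.2 hc0 hcq
  obtain ⟨L, A, γ, τ, hT⟩ := BernoulliEM.exists_thresholds hq.1 hq1 hc0 hE0 hE1 hE2 hE3
  obtain ⟨hexp, hnc, hn576⟩ :=
    BernoulliEM.separation_large hc0 hE0 hE1 hδ (show 8 ≤ m by omega) hnE
  rw [← hT.L_def] at hexp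
  have hlpoly := BernoulliEM.numInit_le hk hwmin hkw hδ h_l hnk
  -- the bad events
  set B₁ : Fin k → Set Ω := fun a =>
    {ω | ((Finset.univ.filter fun j => z j ω = a).card : ℝ) ≤ m * w a * (1 - 1 / 2)} with hB₁
  -- The lower-tail event with `γ = 1`: no initial example has label `a`.
  set B₂ : Fin k → Set Ω := fun a =>
    {ω | ((Finset.univ.filter fun i => z (init ω i) ω = a).card : ℝ) ≤ l * w a * (1 - 1)} with hB₂
  set B₃ : Fin k → Set Ω := fun a =>
    {ω | l * w a + 0.9 * (l * w a) ≤
      ((Finset.univ.filter fun i => z (init ω i) ω = a).card : ℝ)} with hB₃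
  set B₄ : Set Ω := {ω | ∀ i i', i ≠ i' → n * ((1 - q) * (4 * q + √q)) / 2 <
    BernoulliEM.D (BernoulliEM.vec (x (init ω i) ω)) (BernoulliEM.vec (x (init ω i') ω))} with hB₄
  set B₅ : Fin m × Fin m → Set Ω := fun r => {ω | (z r.1 ω = z r.2 ω ∧
      n * (2 * (q * (1 - q)) + L + A) <
        BernoulliEM.D (BernoulliEM.vec (x r.1 ω)) (BernoulliEM.vec (x r.2 ω))) ∨
      (z r.1 ω ≠ z r.2 ω ∧
        BernoulliEM.D (BernoulliEM.vec (x r.1 ω)) (BernoulliEM.vec (x r.2 ω)) <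
        n * ((c * (1 - 2 * q) ^ 2 + 2 * (q * (1 - q))) * (1 - γ)))} with hB₅
  set B₆ : Fin m × Fin m → Set Ω := fun r => {ω | z r.1 ω ≠ z r.2 ω ∧
      BernoulliEM.signedGap (BernoulliEM.vec (P (z r.1 ω))) (BernoulliEM.vec (P (z r.2 ω)))
        (BernoulliEM.vec (x r.1 ω)) (BernoulliEM.vec (x r.2 ω)) <
        n * (c * (1 - 2 * q - τ))} with hB₆
  set K : Finset (Fin m × Fin m) := Finset.univ.filter fun r => r.1 ≠ r.2 with hK
  have hsub : {ω | BernoulliEM.Succeeds P (ε * q) (fun j => z j ω) (fun j => x j ω) (init ω)}ᶜ ⊆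
      (⋃ a ∈ Finset.univ, B₁ a) ∪ ((⋃ a ∈ Finset.univ, B₂ a) ∪ ((⋃ a ∈ Finset.univ, B₃ a) ∪
        (B₄ ∪ ((⋃ r ∈ K, B₅ r) ∪ ⋃ r ∈ K, B₆ r)))) := by
    intro ω hω
    by_contra hgood
    refine hω ?_
    simp only [Set.mem_union, Set.mem_iUnion, Finset.mem_univ, exists_prop, true_and, not_or,
      not_exists, not_and, hK, Finset.mem_filter, Prod.forall, hB₁, hB₂, hB₃, hB₄, hB₅, hB₆,
      Set.mem_ofPred_eq, not_le, not_lt, not_forall] at hgood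
    obtain ⟨g₁, g₂, g₃, g₄, g₅, g₆⟩ := hgood
    refine BernoulliEM.succeeds_of_thresholds hq hB hε hwmin hw hkw hk hc0 hc.le_one hm0 hn576 hnc
      hlpoly hT hcB g₁ (fun a => ?_) g₃ ?_ (fun j j' hj => (g₅ j j' hj).1)
      (fun j j' hj => (g₅ j j' hj).2) g₆
    · have := g₂ a
      rw [sub_self, mul_zero] at this
      exact_mod_cast this
    · obtain ⟨i, i', hne, hD⟩ := g₄
      exact ⟨i, i', hne, hD⟩
  have hlw : ∀ a, 4 * Real.log (2 / (δ * wmin)) ≤ l * w a := fun a =>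
    hl4.trans (mul_le_mul_of_nonneg_left (hw a) (Nat.cast_nonneg l))
  have hlog0 : Real.exp (-Real.log (2 / (δ * wmin))) = δ * wmin / 2 := by
    rw [← Real.log_inv, inv_div, Real.exp_log (by positivity)]
  have p₁ : μ.real (⋃ a ∈ Finset.univ, B₁ a) ≤ δ / 12 := by
    refine (measureReal_biUnion_finset_le _ _).trans ?_
    calc ∑ a, μ.real (B₁ a) ≤ ∑ _a : Fin k, δ / (12 * k) := by
          refine Finset.sum_le_sum fun a _ =>
            (hsample.real_card_label_le hlm hm0 (hw0 a) (by norm_num)).trans ?_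
          refine BernoulliEM.exp_neg_le hδ0 (by positivity) ?_
          rw [div_mul_eq_mul_div, div_le_iff₀ hwmin] at hmw
          have := mul_le_mul_of_nonneg_left (hw a) (Nat.cast_nonneg (α := ℝ) m)
          linarith
      _ = δ / 12 := by simp; field_simp
  have p₂ : μ.real (⋃ a ∈ Finset.univ, B₂ a) ≤ δ / 8 := by
    refine (measureReal_biUnion_finset_le _ _).trans ?_
    calc ∑ a, μ.real (B₂ a) ≤ ∑ _a : Fin k, (δ * wmin / 2) ^ 2 := by
          refine Finset.sum_le_sum fun a _ =>
            (hsample.real_card_init_le hlm hl0 (hw0 a) (by norm_num)).trans ?_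
          -- The exponent `l w_a / 2` is at least twice the logarithm, hence the square.
          rw [← hlog0, ← Real.exp_nat_mul, Real.exp_le_exp]
          push_cast
          linarith [hlw a]
      _ = (k * wmin) * (δ * (δ * wmin)) / 4 := by simp; ring
      _ ≤ 1 * (δ * (1 * (1 / 2))) / 4 := by
          have := hδ.2.le
          gcongr
      _ = δ / 8 := by ring
  have p₃ : μ.real (⋃ a ∈ Finset.univ, B₃ a) ≤ δ / 2 := by
    refine (measureReal_biUnion_finset_le _ _).trans ?_
    calc ∑ a, μ.real (B₃ a) ≤ ∑ _a : Fin k, δ * wmin / 2 := by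
          refine Finset.sum_le_sum fun a _ =>
            (hsample.real_card_init_ge hlm hl0 (hw0 a) (by have := hw0 a; positivity)).trans ?_
          rw [← hlog0, Real.exp_le_exp, neg_le_neg_iff]
          exact BernoulliEM.le_upper_tail_exponent
            (mul_pos (by exact_mod_cast hl0) (hw0 a)) (hlw a)
      _ = (k * wmin) * δ / 2 := by simp; ring
      _ ≤ 1 * δ / 2 := by gcongr
      _ = δ / 2 := by ring
  have p₄ : μ.real B₄ ≤ δ / 50 := by
    refine (hsample.real_no_close_pair_le hq' hlm hn0 hlk).trans ?_
    exact BernoulliEM.chebyshev_bound_sq_le hq1 hn576 hk hδ0 hnk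
  have hKcard : (K.card : ℝ) * Real.exp (-(n * L)) ≤ δ / 12 :=
    BernoulliEM.card_offDiag_mul_le hexp (Real.exp_pos _).le
  have p₅ : μ.real (⋃ r ∈ K, B₅ r) ≤ δ / 12 := by
    refine (measureReal_biUnion_finset_le _ _).trans (le_trans ?_ hKcard)
    rw [← nsmul_eq_mul]
    exact Finset.sum_le_card_nsmul _ _ _ fun r hr =>
      hsample.real_distance_le hq' hlm hn0 hc0 hc hT (by simpa [hK] using hr)
  have p₆ : μ.real (⋃ r ∈ K, B₆ r) ≤ δ / 12 := by
    refine (measureReal_biUnion_finset_le _ _).trans (le_trans ?_ hKcard)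
    rw [← nsmul_eq_mul]
    exact Finset.sum_le_card_nsmul _ _ _ fun r hr =>
      hsample.real_signed_le hq' hlm hn0 hc0 hc hT (by simpa [hK] using hr)
  have hcompl := probReal_compl_eq_one_sub (μ := μ) (hsample.measurableSet_succeeds (ε * q))
  have hbad := measureReal_mono (μ := μ) hsub
  have u₁ := measureReal_union_le (μ := μ) (⋃ a ∈ Finset.univ, B₁ a)
    ((⋃ a ∈ Finset.univ, B₂ a) ∪ ((⋃ a ∈ Finset.univ, B₃ a) ∪
        (B₄ ∪ ((⋃ r ∈ K, B₅ r) ∪ ⋃ r ∈ K, B₆ r))))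
  have u₂ := measureReal_union_le (μ := μ) (⋃ a ∈ Finset.univ, B₂ a)
    ((⋃ a ∈ Finset.univ, B₃ a) ∪ (B₄ ∪ ((⋃ r ∈ K, B₅ r) ∪ ⋃ r ∈ K, B₆ r)))
  have u₃ := measureReal_union_le (μ := μ) (⋃ a ∈ Finset.univ, B₃ a)
    (B₄ ∪ ((⋃ r ∈ K, B₅ r) ∪ ⋃ r ∈ K, B₆ r))
  have u₄ := measureReal_union_le (μ := μ) B₄ ((⋃ r ∈ K, B₅ r) ∪ ⋃ r ∈ K, B₆ r)
  have u₅ := measureReal_union_le (μ := μ) (⋃ r ∈ K, B₅ r) (⋃ r ∈ K, B₆ r)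
  -- `1/12 + 1/8 + 1/2 + 1/50 + 1/12 + 1/12 = 0.895 < 1`.
  linarith only [hcompl, hbad, u₁, u₂, u₃, u₄, u₅, p₁, p₂, p₃, p₄, p₅, p₆, hδ0]
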